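/- A distribution on $[n]$ is a vector $P\in\mathbb{R}_{\ge 0}^n$ with $\sum_x P_x=1$; $\|\cdot\|_p$ is the $\ell_p$ norm on $\mathbb{R}^n$. Distributions $P,Q$ are weakly disjoint if for every $x$ either $P_x=Q_x$, or $P_x>0=Q_x$, or $Q_x>0=P_x$. For a permutation $\pi$ of $[n]$ let $(\pi P)_x=P_{\pi^{-1}(x)}$. An algorithm using $s$ samples is a possibly randomized, computationally unrestricted procedure that receives $s$ independent samples from $X$, $s$ from $Y$ and $s$ from $T\in\{X,Y\}$, and answers "first" or "second". It solves the distinguishability problem with error $\varepsilon$ for a class $\mathcal{P}$ of pairs of distributions if for every $(X,Y)\in\mathcal{P}$: when $X\ne Y$, it answers "first" with probability at least $1-\varepsilon$ if $T=X$ and "second" with probability at least $1-\varepsilon$ if $T=Y$; when $X=Y$, it gives each of the two answers with probability at least $\frac12-\varepsilon$. A function $L:\mathbb{N}\to\mathbb{R}$ is polylogarithmic if $L(s)=O((\log s)^k)$ as $s\to\infty$, for some $k$. **Theorem.** There is a universal constant $c>0$ such that the following holds. For all $n,s$ and all weakly disjoint distributions $P\neq Q$ on $[n]$, consider the condition $$s\le\min\left\{\frac{0.25}{\|P-Q\|_3},\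 \frac1{\|P\|_\infty},\ \frac1{\|Q\|_\infty},\ \frac1c\cdot\frac{\|P+Q\|_2}{\|P-Q\|_2^2}\right\}.\tag{$*$}$$ 1. There is a universal constant $\varepsilon_0>0$ such that for all $n,s,P,Q$ as above satisfying $(*)$, no algorithm using $s$ samples solves the distinguishability problem with error $\varepsilon_0$ for the class $\{(\pi P,\pi Q):\pi \text{ a permutation of } [n]\}$. 2. Consequently, for every polylogarithmic $L$ there is $s_0$ (depending only on $L$) such that for all $n,s,P,Q$ as above satisfying $(*)$ and $s\ge s_0$, no algorithm using $s$ samples solves the distinguishability problem with error $L(s)/s^2$ for this class. -/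

import Mathlib

open scoped ENNReal

noncomputable section

namespace Distinguishability

/-- A probability distribution on the domain `{0, …, n-1}`: a point of the standard simplex. -/
abbrev Dist (n : ℕ) : Type := stdSimplex ℝ (Fin n)

/-- The `ℓ_p` norm of a real vector. -/
def lpNorm (p : ℝ≥0∞) {n : ℕ} (v : Fin n → ℝ) : ℝ := ‖(WithLp.toLp p v : PiLp p fun _ : Fin n => ℝ)‖

/-- On each element the two distributions are equal, or exactly one of them is zero. -/
def WeaklyDisjoint {n : ℕ} (P Q : Dist n) : Prop :=
  ∀ x, P.1 x = Q.1 x ∨ (0 < P.1 x ∧ Q.1 x = 0) ∨ (0 < Q.1 x ∧ P.1 x = 0)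

/-- The permuted distribution `πP`, which gives `π x` the mass that `P` gives `x`. -/
def permute {n : ℕ} (π : Equiv.Perm (Fin n)) (P : Dist n) : Dist n :=
  ⟨fun x => P.1 (π.symm x), fun x => P.2.1 _, by rw [Equiv.sum_comp π.symm P.1]; exact P.2.2⟩

/-- The class of all pairs `(πP, πQ)`. -/
def permutedPairs {n : ℕ} (P Q : Dist n) : Set (Dist n × Dist n) :=
  Set.range fun π : Equiv.Perm (Fin n) => (permute π P, permute π Q)

/-- A sequence of `s` samples. -/
abbrev Sample (n s : ℕ) : Type := Fin s → Fin n

/-- The probability of drawing the sequence `x` in `s` independent draws from `P`. -/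
def sampleProb {n s : ℕ} (P : Dist n) (x : Sample n s) : ℝ := ∏ i, P.1 (x i)

/-- A (possibly randomized, computationally unrestricted) algorithm that receives `s` training
samples from the first distribution, `s` training samples from the second one, and `s` testing
samples; its value is the probability, over its internal coins, that it answers "first"
(otherwise it answers "second"). -/
abbrev Algorithm (n s : ℕ) : Type := Sample n s → Sample n s → Sample n s → unitInterval

/-- The probability that `A` answers "first" when the training samples come from `X` and `Y` and
the testing samples from `T`, all draws being independent. -/
def probFirst {n s : ℕ} (A : Algorithm n s) (X Y T : Dist n) : ℝ :=
  ∑ x : Sample n s, ∑ y : Sample n s, ∑ t : Sample n s,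
    sampleProb X x * sampleProb Y y * sampleProb T t * (A x y t : ℝ)

/-- The probability that `A` answers "second" in the same situation. -/
def probSecond {n s : ℕ} (A : Algorithm n s) (X Y T : Dist n) : ℝ :=
  ∑ x : Sample n s, ∑ y : Sample n s, ∑ t : Sample n s,
    sampleProb X x * sampleProb Y y * sampleProb T t * (1 - (A x y t : ℝ))

/-- `A` solves the distinguishability problem for the class `C` of pairs with error `ε`: for
distinct `X`, `Y` it answers correctly with probability at least `1 - ε`, whichever of the two
generated the testing samples; for identical ones it gives each of the two answers with
probability at least `1/2 - ε`. -/
def Solves {n s : ℕ} (A : Algorithm n s) (ε : ℝ) (C : Set (Dist n × Dist n)) : Prop :=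
  ∀ X Y : Dist n, (X, Y) ∈ C →
    (X ≠ Y → 1 - ε ≤ probFirst A X Y X ∧ 1 - ε ≤ probSecond A X Y Y) ∧
    (X = Y → 1 / 2 - ε ≤ probFirst A X Y X ∧ 1 / 2 - ε ≤ probSecond A X Y X)

/-- `L(s) = polylog(s)`: it is `O((log s)^k)` for some `k`. -/
def IsPolylog (L : ℕ → ℝ) : Prop :=
  ∃ k : ℕ, L =O[Filter.atTop] fun s : ℕ => Real.log (s : ℝ) ^ k

/-- The bound on the number of samples. -/
def sampleBound (c : ℝ) {n : ℕ} (P Q : Dist n) : ℝ :=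
  min (min (0.25 / lpNorm 3 (P.1 - Q.1)) (1 / lpNorm ∞ P.1))
    (min (1 / lpNorm ∞ Q.1) (1 / c * (lpNorm 2 (P.1 + Q.1) / lpNorm 2 (P.1 - Q.1) ^ 2)))

end Distinguishability

end

/-! An algorithm can be averaged over relabellings of the domain and over reorderings within each
class of samples, so that it sees only the pattern of coincidences. Let D be the set where P and Q
differ. A testing sample in D that meets no other sample looks like a fresh element, whichever
distribution produced it; only collisions inside D carry information. Replacing every testing sample
in D by a fresh element yields a law that is the same for T = P and T = Q (`expect_forget_eq`). It
therefore suffices that the replacement moves the probability of "first" by at most 5/16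
(`abs_expect_sub_forget_le`): the two cases then differ by at most 5/8, less than the 3/4 that error
1/8 requires.

The replacement is hidden by accidental collisions on the common part. Elements there are paired
greedily (`exists_pairing`), and a sample is drawn in two stages: a label, then a fair coin that
chooses between `u i` and `v i` if the label is the pair i. When one sample of class κ and one
testing sample carry the label i and nothing else touches the pair, their coins decide whether they
collide. With M such pairs the number of collisions is binomial, so one extra collision of the same
type changes the mean of a bounded exchangeable statistic by at most 2/√M (`abs_coinMean_sub_le`,
`abs_hybrid_step_le`).

Let σ = s²‖P - Q‖₂² and let Y be s² times the sum of the squared smaller masses of the pairs. At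
most 2σ informative collisions are expected, and M is at least a constant times Y outside a small
probability (`expect_few_hitPairs_le`), so the total cost is O(σ/√Y). The ℓ₂ condition makes this
small, the ℓ₃ condition makes triple collisions in D unlikely, and the ℓ∞ conditions leave a
constant probability that no further sample touches a given pair. If σ ≤ 1/16, informative
collisions are rare and need no hiding. The second claim follows because L(s)/s² tends to 0. -/

noncomputable section

namespace Distinguishability

set_option linter.unusedSectionVars false

/-! ### Product laws and a second-moment bound for blocks hit by exactly two samples. -/

section ProductLaw

variable {C Λ : Type*} [Fintype C] [DecidableEq C] [Fintype Λ] [DecidableEq Λ]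

/-- The expectation of `f` when the coordinates are drawn independently, coordinate `c` with
weights `m c`. -/
def expect (m : C → Λ → ℝ) (f : (C → Λ) → ℝ) : ℝ := ∑ l : C → Λ, (∏ c, m c (l c)) * f l

theorem expect_prod (m g : C → Λ → ℝ) :
    expect m (fun l => ∏ c, g c (l c)) = ∏ c, ∑ x, m c x * g c x := by
  simp only [expect, Finset.prod_univ_sum, Fintype.piFinset_univ, Finset.prod_mul_distrib]

theorem expect_add (m : C → Λ → ℝ) (f g : (C → Λ) → ℝ) :
    expect m (fun l => f l + g l) = expect m f + expect m g := by
  simp only [expect, mul_add, Finset.sum_add_distrib]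

theorem expect_sub (m : C → Λ → ℝ) (f g : (C → Λ) → ℝ) :
    expect m (fun l => f l - g l) = expect m f - expect m g := by
  simp only [expect, mul_sub, Finset.sum_sub_distrib]

theorem expect_const_mul (m : C → Λ → ℝ) (a : ℝ) (f : (C → Λ) → ℝ) :
    expect m (fun l => a * f l) = a * expect m f := by
  simp only [expect, Finset.mul_sum]
  exact Finset.sum_congr rfl fun l _ => by ring

theorem expect_sum {ι : Type*} (S : Finset ι) (m : C → Λ → ℝ) (f : ι → (C → Λ) → ℝ) :
    expect m (fun l => ∑ i ∈ S, f i l) = ∑ i ∈ S, expect m (f i) := by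
  simp only [expect, Finset.mul_sum]
  exact Finset.sum_comm

theorem expect_mono {m : C → Λ → ℝ} (hm : ∀ c x, 0 ≤ m c x) {f g : (C → Λ) → ℝ}
    (h : ∀ l, f l ≤ g l) : expect m f ≤ expect m g :=
  Finset.sum_le_sum fun l _ =>
    mul_le_mul_of_nonneg_left (h l) (Finset.prod_nonneg fun c _ => hm c _)

theorem expect_const {m : C → Λ → ℝ} (hm : ∀ c, ∑ x, m c x = 1) (a : ℝ) :
    expect m (fun _ => a) = a := by
  have h := expect_prod m (fun _ _ => 1)
  simp only [Finset.prod_const_one, mul_one, hm] at h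
  have := expect_const_mul m a (fun _ => 1)
  simpa [h] using this

theorem abs_expect_le {m : C → Λ → ℝ} (hm : ∀ c x, 0 ≤ m c x) (f : (C → Λ) → ℝ) :
    |expect m f| ≤ expect m (fun l => |f l|) := by
  refine (Finset.abs_sum_le_sum_abs _ _).trans (Finset.sum_le_sum fun l _ => ?_)
  rw [abs_mul, abs_of_nonneg (Finset.prod_nonneg fun c _ => hm c _)]

/-- The probability that all coordinates in `S` take the value `x`. -/
theorem expect_cylinder {m : C → Λ → ℝ} (hm : ∀ c, ∑ x, m c x = 1) (S : Finset C) (x : Λ) :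
    expect m (fun l => if ∀ c ∈ S, l c = x then 1 else 0) = ∏ c ∈ S, m c x := by
  have h : (fun l : C → Λ => if ∀ c ∈ S, l c = x then (1 : ℝ) else 0) =
      fun l => ∏ c, if c ∈ S then (if l c = x then (1 : ℝ) else 0) else 1 := by
    funext l
    simp only [Finset.prod_ite_mem, Finset.univ_inter]
    rw [Finset.prod_ite_zero]
    simp
  rw [h, expect_prod m (fun c y => if c ∈ S then (if y = x then (1 : ℝ) else 0) else 1)]
  rw [← Finset.univ_inter S, ← Finset.prod_ite_mem]
  refine Finset.prod_congr rfl fun c _ => ?_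
  simp only [Finset.univ_inter]
  split_ifs
  · simp
  · simp [hm]

/-- The image of a product law under coordinatewise maps is the product of the image laws. -/
theorem expect_map {Ω : Type*} [Fintype Ω] [DecidableEq Ω] (m : C → Λ → ℝ) (q : C → Ω → ℝ)
    (ψ : C → Λ → Ω) (h : ∀ c w, q c w = ∑ x, if ψ c x = w then m c x else 0)
    (F : (C → Ω) → ℝ) : expect q F = expect m (fun l => F (fun c => ψ c (l c))) := by
  have h1 : ∀ w : C → Ω, (∏ c, q c (w c)) =
      ∑ l : C → Λ, if (fun c => ψ c (l c)) = w then ∏ c, m c (l c) else 0 := by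
    intro w
    simp only [h, Finset.prod_univ_sum, Fintype.piFinset_univ]
    refine Finset.sum_congr rfl fun l _ => ?_
    rw [Finset.prod_ite_zero]
    simp [funext_iff]
  simp only [expect, h1, Finset.sum_mul]
  rw [Finset.sum_comm]
  refine Finset.sum_congr rfl fun l _ => ?_
  simp [ite_mul]

/-- Chebyshev's inequality for the lower tail at half the mean. -/
theorem expect_lower_tail {m : C → Λ → ℝ} (hm : ∀ c x, 0 ≤ m c x) (hm1 : ∀ c, ∑ x, m c x = 1)
    {X : (C → Λ) → ℝ} {μ B : ℝ} (hμ : 0 < μ) (h1 : expect m X = μ)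
    (h2 : expect m (fun l => X l ^ 2) ≤ μ + B * μ ^ 2) :
    expect m (fun l => if X l < μ / 2 then 1 else 0) ≤ 4 / μ + 4 * (B - 1) := by
  have hv : expect m (fun l => (X l - μ) ^ 2) ≤ μ + (B - 1) * μ ^ 2 := by
    have : ∀ l, (X l - μ) ^ 2 = X l ^ 2 - (2 * μ) * X l + μ ^ 2 := fun l => by ring
    simp only [this]
    rw [expect_add, expect_sub, expect_const_mul, h1, expect_const hm1]
    nlinarith
  have hle : (μ ^ 2 / 4) * expect m (fun l => if X l < μ / 2 then 1 else 0) ≤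
      expect m (fun l => (X l - μ) ^ 2) := by
    rw [← expect_const_mul]
    refine expect_mono hm fun l => ?_
    split_ifs with h
    · nlinarith
    · nlinarith [sq_nonneg (X l - μ)]
  have h3 : (μ ^ 2 / 4) * (4 / μ + 4 * (B - 1)) = μ + (B - 1) * μ ^ 2 := by
    field_simp
  have h4 : 0 < μ ^ 2 / 4 := by positivity
  exact le_of_mul_le_mul_left (by rw [h3]; exact hle.trans hv) h4

/-- The indicator that exactly the coordinates `a` and `b` hit the block `blk`, and do so at `x`. -/
def soleHit (blk : Finset Λ) (x : Λ) (a b : C) (l : C → Λ) : ℝ :=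
  ∏ c, if c = a ∨ c = b then (if l c = x then 1 else 0) else (if l c ∈ blk then 0 else 1)

theorem prod_two_factors (a b : C) (hab : a ≠ b) (x : ℝ) :
    (∏ c, if c = a ∨ c = b then x else 1) = x ^ 2 := by
  have : ∀ c, (if c = a ∨ c = b then x else 1) = (if c = a then x else 1) * (if c = b then x else 1) := by
    intro c
    by_cases h1 : c = a <;> by_cases h2 : c = b <;> simp_all
  simp only [this, Finset.prod_mul_distrib, Finset.prod_ite_eq', Finset.mem_univ, if_true]
  ring

/-- Two coordinates contribute `r` and all others `ρ`; dividing by `ρ` twice avoids the exponent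
`Fintype.card C - 2`. -/
theorem expect_soleHit {m : C → Λ → ℝ} {blk : Finset Λ} {x : Λ} {r ρ : ℝ}
    (hr : ∀ c, m c x = r) (hρ : ∀ c, ∑ y, (if y ∈ blk then 0 else m c y) = ρ) (hρ0 : 0 < ρ)
    {a b : C} (hab : a ≠ b) :
    expect m (soleHit blk x a b) = (r / ρ) ^ 2 * ρ ^ Fintype.card C := by
  unfold soleHit
  rw [expect_prod m (fun c y => if c = a ∨ c = b then (if y = x then 1 else 0)
    else (if y ∈ blk then 0 else 1)), ← prod_two_factors a b hab, ← Finset.card_univ,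
    ← Finset.prod_const, ← Finset.prod_mul_distrib]
  refine Finset.prod_congr rfl fun c _ => ?_
  split_ifs with h
  · simp [hr, div_mul_cancel₀ r hρ0.ne']
  · simp [hρ]

/-- Hits on disjoint blocks are nearly independent, by comparison coordinate by coordinate. A
coordinate prescribed by both hits contributes 0. A coordinate prescribed by one of them exceeds the
independent value by a factor `1 / ρ` or `1 / ρ'`, at most `K`, which is paid at most four times. A
coordinate prescribed by neither contributes `ρ + ρ' - 1 ≤ ρ * ρ'`. -/
theorem expect_soleHit_mul_le {m : C → Λ → ℝ} (hm : ∀ c x, 0 ≤ m c x) (hm1 : ∀ c, ∑ x, m c x = 1)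
    {blk blk' : Finset Λ} (hd : Disjoint blk blk') {x x' : Λ} (hx : x ∈ blk) (hx' : x' ∈ blk')
    {r ρ r' ρ' K : ℝ}
    (hr : ∀ c, m c x = r) (hρ : ∀ c, ∑ y, (if y ∈ blk then 0 else m c y) = ρ) (hρ0 : 0 < ρ)
    (hr' : ∀ c, m c x' = r') (hρ' : ∀ c, ∑ y, (if y ∈ blk' then 0 else m c y) = ρ')
    (hρ0' : 0 < ρ') (hK : 1 ≤ K * ρ) (hK' : 1 ≤ K * ρ')
    {a b a' b' : C} (hab : a ≠ b) (hab' : a' ≠ b') :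
    expect m (fun l => soleHit blk x a b l * soleHit blk' x' a' b' l) ≤
      K ^ 4 * ((r / ρ) ^ 2 * ρ ^ Fintype.card C) * ((r' / ρ') ^ 2 * ρ' ^ Fintype.card C) := by
  have hr0 : 0 ≤ r := hr a ▸ hm a x
  have hr0' : 0 ≤ r' := hr' a ▸ hm a x'
  have hK0 : 0 < K := by
    by_contra h
    nlinarith
  unfold soleHit
  simp only [← Finset.prod_mul_distrib]
  rw [expect_prod m (fun c y => (if c = a ∨ c = b then (if y = x then 1 else 0)
    else (if y ∈ blk then 0 else 1)) * (if c = a' ∨ c = b' then (if y = x' then 1 else 0)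
    else (if y ∈ blk' then 0 else 1)))]
  have e : K ^ 4 * ((r / ρ) ^ 2 * ρ ^ Fintype.card C) * ((r' / ρ') ^ 2 * ρ' ^ Fintype.card C) =
      ∏ c, ((if c = a ∨ c = b then K * (r / ρ) else 1) *
        (if c = a' ∨ c = b' then K * (r' / ρ') else 1) * (ρ * ρ')) := by
    rw [Finset.prod_mul_distrib, Finset.prod_mul_distrib, prod_two_factors a b hab,
      prod_two_factors a' b' hab', Finset.prod_const, Finset.card_univ]
    ring
  rw [e]
  refine Finset.prod_le_prod (fun c _ => Finset.sum_nonneg fun y _ => mul_nonneg (hm c y) ?_)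
    fun c _ => ?_
  · refine mul_nonneg ?_ ?_ <;> split_ifs <;> norm_num
  have hxx : x ≠ x' := fun h => Finset.disjoint_left.1 hd hx (h ▸ hx')
  have hx2 : x ∉ blk' := Finset.disjoint_left.1 hd hx
  have hx2' : x' ∉ blk := Finset.disjoint_right.1 hd hx'
  by_cases h : c = a ∨ c = b <;> by_cases h' : c = a' ∨ c = b' <;>
    simp only [h, h', if_true, if_false]
  · have : ∀ y, m c y * ((if y = x then 1 else 0) * (if y = x' then 1 else 0)) = 0 := by
      intro y
      by_cases h1 : y = x
      · simp [h1, hxx]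
      · simp [h1]
    simp only [this, Finset.sum_const_zero]
    positivity
  · have : ∀ y, m c y * ((if y = x then 1 else 0) * (if y ∈ blk' then 0 else 1)) =
        if y = x then m c y else 0 := by
      intro y
      by_cases h1 : y = x
      · simp [h1, hx2]
      · simp [h1]
    simp only [this, Finset.sum_ite_eq', Finset.mem_univ, if_true, hr]
    have : K * (r / ρ) * 1 * (ρ * ρ') = r * (K * ρ') := by field_simp
    rw [this]
    nlinarith
  · have : ∀ y, m c y * ((if y ∈ blk then 0 else 1) * (if y = x' then 1 else 0)) =
        if y = x' then m c y else 0 := by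
      intro y
      by_cases h1 : y = x'
      · simp [h1, hx2']
      · simp [h1]
    simp only [this, Finset.sum_ite_eq', Finset.mem_univ, if_true, hr']
    have : 1 * (K * (r' / ρ')) * (ρ * ρ') = r' * (K * ρ) := by field_simp
    rw [this]
    nlinarith
  · have h1 : ∀ y, m c y * ((if y ∈ blk then 0 else 1) * (if y ∈ blk' then 0 else 1)) =
        (if y ∈ blk then 0 else m c y) + (if y ∈ blk' then 0 else m c y) - m c y := by
      intro y
      by_cases h1 : y ∈ blk
      · simp [h1, Finset.disjoint_left.1 hd h1]
      · by_cases h2 : y ∈ blk' <;> simp [h1, h2]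
    simp only [h1, Finset.sum_sub_distrib, Finset.sum_add_distrib, hρ, hρ', hm1]
    have h2 : ρ ≤ 1 := by
      rw [← hρ c, ← hm1 c]
      exact Finset.sum_le_sum fun y _ => by split_ifs <;> simp [hm]
    have h3 : ρ' ≤ 1 := by
      rw [← hρ' c, ← hm1 c]
      exact Finset.sum_le_sum fun y _ => by split_ifs <;> simp [hm]
    nlinarith

theorem soleHit_eq_one_or_zero (blk : Finset Λ) (x : Λ) (a b : C) (l : C → Λ) :
    (soleHit blk x a b l = 1 ∧ l a = x ∧ l b = x ∧ ∀ c, c ≠ a → c ≠ b → l c ∉ blk) ∨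
      soleHit blk x a b l = 0 := by
  by_cases h : l a = x ∧ l b = x ∧ ∀ c, c ≠ a → c ≠ b → l c ∉ blk
  · refine Or.inl ⟨Finset.prod_eq_one fun c _ => ?_, h⟩
    obtain ⟨ha, hb, hc⟩ := h
    split_ifs with h1 h2 h3
    · rfl
    · rcases h1 with rfl | rfl <;> contradiction
    · exact absurd h3 (hc c (fun h => h1 (Or.inl h)) (fun h => h1 (Or.inr h)))
    · rfl
  · right
    by_contra h0
    apply h
    have hne := Finset.prod_ne_zero_iff.1 h0
    refine ⟨?_, ?_, fun c hca hcb hcblk => ?_⟩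
    · by_contra h1
      exact hne a (Finset.mem_univ _) (by simp [h1])
    · by_contra h1
      exact hne b (Finset.mem_univ _) (by simp [h1])
    · exact hne c (Finset.mem_univ _) (by simp [hca, hcb, hcblk])

/-- At most one pair from an antisymmetric set of pairs is a sole hit. -/
theorem sum_soleHit_le_one {blk : Finset Λ} {x : Λ} (hx : x ∈ blk) {A : Finset (C × C)}
    (hA : ∀ p ∈ A, p.1 ≠ p.2) (hA' : ∀ p ∈ A, (p.2, p.1) ∉ A) (l : C → Λ) :
    ((∀ p ∈ A, soleHit blk x p.1 p.2 l = 0) ∧ ∑ p ∈ A, soleHit blk x p.1 p.2 l = 0) ∨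
    ((∃ p ∈ A, soleHit blk x p.1 p.2 l = 1) ∧ ∑ p ∈ A, soleHit blk x p.1 p.2 l = 1) := by
  by_cases h : ∃ p ∈ A, soleHit blk x p.1 p.2 l = 1
  · refine Or.inr ⟨h, ?_⟩
    obtain ⟨p, hp, hp1⟩ := h
    rw [Finset.sum_eq_single_of_mem p hp, hp1]
    intro q hq hqp
    rcases soleHit_eq_one_or_zero blk x q.1 q.2 l with ⟨-, h1, h2, h3⟩ | h0
    · exfalso
      rcases soleHit_eq_one_or_zero blk x p.1 p.2 l with ⟨-, g1, g2, g3⟩ | h0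
      · have a1 : p.1 = q.1 ∨ p.1 = q.2 := by
          by_contra hc
          push Not at hc
          exact h3 _ hc.1 hc.2 (g1 ▸ hx)
        have a2 : p.2 = q.1 ∨ p.2 = q.2 := by
          by_contra hc
          push Not at hc
          exact h3 _ hc.1 hc.2 (g2 ▸ hx)
        have hp' := hA p hp
        have hq' := hA' p hp
        rcases a1 with a1 | a1 <;> rcases a2 with a2 | a2
        · exact hp' (a1.trans a2.symm)
        · exact hqp (Prod.ext a1.symm a2.symm)
        · rw [a1, a2] at hq'
          exact hq' hq
        · exact hp' (a1.trans a2.symm)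
      · rw [hp1] at h0
        exact one_ne_zero h0
    · exact h0
  · left
    have h0 : ∀ p ∈ A, soleHit blk x p.1 p.2 l = 0 := by
      intro p hp
      rcases soleHit_eq_one_or_zero blk x p.1 p.2 l with ⟨h1, -⟩ | h0
      · exact absurd ⟨p, hp, h1⟩ h
      · exact h0
    exact ⟨h0, Finset.sum_eq_zero h0⟩

/-- First two moments, and hence the lower tail, of the number of blocks that are hit by exactly
one of the pairs of coordinates in `A`. -/
theorem expect_soleHit_lower_tail {ι : Type*} [Fintype ι] [DecidableEq ι] {m : C → Λ → ℝ}
    (hm : ∀ c x, 0 ≤ m c x) (hm1 : ∀ c, ∑ x, m c x = 1)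
    {blk : ι → Finset Λ} (hd : ∀ i j, i ≠ j → Disjoint (blk i) (blk j)) {x : ι → Λ}
    (hx : ∀ i, x i ∈ blk i) {r ρ : ι → ℝ} {K : ℝ} (hr : ∀ i c, m c (x i) = r i)
    (hρ : ∀ i c, ∑ y, (if y ∈ blk i then 0 else m c y) = ρ i) (hρ0 : ∀ i, 0 < ρ i)
    (hK : ∀ i, 1 ≤ K * ρ i) {A : Finset (C × C)}
    (hA : ∀ p ∈ A, p.1 ≠ p.2) (hA' : ∀ p ∈ A, (p.2, p.1) ∉ A) {μ : ℝ} (hμ0 : 0 < μ)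
    (hμ : μ = ∑ i, (A.card : ℝ) * ((r i / ρ i) ^ 2 * ρ i ^ Fintype.card C)) :
    expect m (fun l => if ((Finset.univ.filter fun i : ι =>
      ∃ p ∈ A, soleHit (blk i) (x i) p.1 p.2 l = 1).card : ℝ) < μ / 2 then 1 else 0) ≤
      4 / μ + 4 * (K ^ 4 - 1) := by
  have hX : ∀ l : C → Λ, ((Finset.univ.filter fun i : ι =>
      ∃ p ∈ A, soleHit (blk i) (x i) p.1 p.2 l = 1).card : ℝ) =
      ∑ i, ∑ p ∈ A, soleHit (blk i) (x i) p.1 p.2 l := by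
    intro l
    rw [Finset.card_filter]
    push_cast
    refine Finset.sum_congr rfl fun i _ => ?_
    rcases sum_soleHit_le_one (hx i) hA hA' l with ⟨h1, h2⟩ | ⟨h1, h2⟩
    · rw [h2, if_neg]
      rintro ⟨p, hp, hp1⟩
      rw [h1 p hp] at hp1
      exact zero_ne_one hp1
    · rw [h2, if_pos h1]
  simp only [hX]
  have hE : ∀ i, expect m (fun l => ∑ p ∈ A, soleHit (blk i) (x i) p.1 p.2 l) =
      (A.card : ℝ) * ((r i / ρ i) ^ 2 * ρ i ^ Fintype.card C) := by
    intro i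
    rw [expect_sum, Finset.sum_congr rfl fun p hp =>
      expect_soleHit (hr i) (hρ i) (hρ0 i) (hA p hp), Finset.sum_const, nsmul_eq_mul]
  refine expect_lower_tail hm hm1 hμ0 ?_ ?_
  · rw [expect_sum, hμ]
    exact Finset.sum_congr rfl fun i _ => hE i
  -- The count for one block is 0 or 1, hence equal to its square: the diagonal gives the mean, and
  -- only distinct blocks need near-independence.
  have hsq : ∀ l : C → Λ, (∑ i, ∑ p ∈ A, soleHit (blk i) (x i) p.1 p.2 l) ^ 2 =
      ∑ i, ∑ j, if i = j then ∑ p ∈ A, soleHit (blk i) (x i) p.1 p.2 l else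
        ∑ p ∈ A, ∑ q ∈ A, soleHit (blk i) (x i) p.1 p.2 l * soleHit (blk j) (x j) q.1 q.2 l := by
    intro l
    rw [sq, Finset.sum_mul_sum]
    refine Finset.sum_congr rfl fun i _ => Finset.sum_congr rfl fun j _ => ?_
    split_ifs with h
    · subst h
      rcases sum_soleHit_le_one (hx i) hA hA' l with ⟨h1, h2⟩ | ⟨h1, h2⟩ <;> rw [h2] <;> norm_num
    · rw [Finset.sum_mul_sum]
  simp only [hsq]
  rw [expect_sum]
  simp only [expect_sum]
  have hterm : ∀ i j, expect m (fun l => if i = j then ∑ p ∈ A, soleHit (blk i) (x i) p.1 p.2 l else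
        ∑ p ∈ A, ∑ q ∈ A, soleHit (blk i) (x i) p.1 p.2 l * soleHit (blk j) (x j) q.1 q.2 l) ≤
      (if i = j then (A.card : ℝ) * ((r i / ρ i) ^ 2 * ρ i ^ Fintype.card C) else 0) +
      K ^ 4 * (((A.card : ℝ) * ((r i / ρ i) ^ 2 * ρ i ^ Fintype.card C)) *
        ((A.card : ℝ) * ((r j / ρ j) ^ 2 * ρ j ^ Fintype.card C))) := by
    intro i j
    have := (hρ0 i).le
    have := (hρ0 j).le
    by_cases h : i = j
    · simp only [h, if_true]
      rw [hE]
      have : 0 ≤ K ^ 4 * (((A.card : ℝ) * ((r j / ρ j) ^ 2 * ρ j ^ Fintype.card C)) *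
        ((A.card : ℝ) * ((r j / ρ j) ^ 2 * ρ j ^ Fintype.card C))) := by positivity
      linarith
    · simp only [h, if_false, zero_add]
      simp only [expect_sum]
      calc _ ≤ ∑ p ∈ A, ∑ q ∈ A, K ^ 4 * ((r i / ρ i) ^ 2 * ρ i ^ Fintype.card C) *
              ((r j / ρ j) ^ 2 * ρ j ^ Fintype.card C) :=
            Finset.sum_le_sum fun p hp => Finset.sum_le_sum fun q hq =>
              expect_soleHit_mul_le hm hm1 (hd i j h) (hx i) (hx j) (hr i) (hρ i) (hρ0 i)
                (hr j) (hρ j) (hρ0 j) (hK i) (hK j) (hA p hp) (hA q hq)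
        _ = _ := by
            simp only [Finset.sum_const, nsmul_eq_mul]
            ring
  refine (Finset.sum_le_sum fun i _ => Finset.sum_le_sum fun j _ => hterm i j).trans (le_of_eq ?_)
  rw [sq, hμ, Finset.sum_mul_sum, Finset.mul_sum, ← Finset.sum_add_distrib]
  refine Finset.sum_congr rfl fun i _ => ?_
  rw [Finset.sum_add_distrib, Finset.sum_ite_eq, if_pos (Finset.mem_univ _), Finset.mul_sum]

end ProductLaw

/-! ### Smoothing by fair coins: a binomial count hides a shift by one. -/

section Smoothing

variable {C : Type*} [Fintype C] [DecidableEq C]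

/-- Reverse the coin at `c`. -/
def flip (c : C) (β : C → Bool) : C → Bool := Function.update β c (!β c)

theorem flip_involutive (c : C) : Function.Involutive (flip c) := by
  intro β
  simp [flip]

theorem flip_self (c : C) (β : C → Bool) : flip c β c = !β c := by simp [flip]

theorem flip_of_ne {c x : C} (h : x ≠ c) (β : C → Bool) : flip c β x = β x := by simp [flip, h]

theorem sum_flip (c : C) (f : (C → Bool) → ℝ) : ∑ β, f (flip c β) = ∑ β, f β :=
  Equiv.sum_comp (flip_involutive c).toPerm f

/-- The mean over independent fair coins. -/
def coinMean (f : (C → Bool) → ℝ) : ℝ := (∑ β, f β) / 2 ^ Fintype.card C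

theorem coinMean_abs_le {f : (C → Bool) → ℝ} {b : ℝ} (h : ∀ β, |f β| ≤ b) : |coinMean f| ≤ b := by
  unfold coinMean
  rw [abs_div, abs_of_pos (by positivity : (0 : ℝ) < 2 ^ Fintype.card C), div_le_iff₀ (by positivity)]
  refine (Finset.abs_sum_le_sum_abs _ _).trans ((Finset.sum_le_sum fun β _ => h β).trans ?_)
  simp [mul_comm]

theorem coinMean_sub (f g : (C → Bool) → ℝ) :
    coinMean (fun β => f β - g β) = coinMean f - coinMean g := by
  simp [coinMean, Finset.sum_sub_distrib, sub_div]

/-- If pairs of coins are hidden, then an extra coincidence within a pair changes the mean of a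
bounded statistic by at most `2 / √(number of pairs)`. -/
theorem abs_coinMean_sub_le {ι : Type*} [DecidableEq ι] (E : Finset ι) (e o : ι → C)
    (he : ∀ i ∈ E, ∀ j ∈ E, i ≠ j → e i ≠ e j) (ho : ∀ i ∈ E, ∀ j ∈ E, o i ≠ e j)
    {H₀ H₁ : (C → Bool) → ℝ} (h0 : ∀ β, 0 ≤ H₀ β ∧ H₀ β ≤ 1) (h1 : ∀ β, 0 ≤ H₁ β ∧ H₁ β ≤ 1)
    (h : ∀ i ∈ E, ∀ β, β (o i) ≠ β (e i) → H₁ β = H₀ (flip (e i) β))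
    {η : ℝ} (hη : 0 ≤ η) (hE : 4 ≤ η ^ 2 * E.card) :
    |coinMean H₁ - coinMean H₀| ≤ η := by
  set sep : ι → (C → Bool) → ℝ := fun i β => if β (o i) ≠ β (e i) then 1 else 0 with hsep
  set M : ℝ := (E.card : ℝ) with hM
  set S : (C → Bool) → ℝ := fun β => ∑ i ∈ E, sep i β with hS
  have hflip : ∀ i ∈ E, ∀ β, sep i (flip (e i) β) = 1 - sep i β := by
    intro i hi β
    simp only [hsep, flip_self, flip_of_ne (ho i hi i hi)]
    cases β (o i) <;> cases β (e i) <;> simp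
  have hflip' : ∀ i ∈ E, ∀ j ∈ E, i ≠ j → ∀ β, sep j (flip (e i) β) = sep j β := by
    intro i hi j hj hij β
    simp only [hsep, flip_of_ne (ho j hj i hi), flip_of_ne (he j hj i hi hij.symm)]
  -- `S` counts the separated pairs. Reversing the coin `e i` exchanges the separated and the
  -- coinciding states of pair `i`, and `h` matches `H₁` on the former with `H₀` on the latter.
  -- Summing over `i` weights `H₁` by `S` and `H₀` by `M - S`.
  have key : ∑ β, S β * H₁ β = ∑ β, (M - S β) * H₀ β := by
    have e1 : ∀ β, (M - S β) * H₀ β = ∑ i ∈ E, (1 - sep i β) * H₀ β := by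
      intro β
      rw [← Finset.sum_mul, Finset.sum_sub_distrib]
      simp [hS, hM]
    rw [Finset.sum_congr rfl fun β _ => e1 β]
    simp only [hS, Finset.sum_mul]
    rw [Finset.sum_comm]
    conv_rhs => rw [Finset.sum_comm]
    refine Finset.sum_congr rfl fun i hi => ?_
    rw [← sum_flip (e i)]
    refine Finset.sum_congr rfl fun β _ => ?_
    rw [hflip i hi]
    by_cases hs : β (o i) ≠ β (e i)
    · simp [hsep, hs]
    · have hs' : flip (e i) β (o i) ≠ flip (e i) β (e i) := by
        rw [flip_self, flip_of_ne (ho i hi i hi)]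
        cases h1 : β (o i) <;> cases h2 : β (e i) <;> simp_all
      rw [h i hi _ hs', flip_involutive]
  -- The signs `1 - 2 * sep i` are pairwise uncorrelated, since reversing `e i` changes only the
  -- `i`-th sign.
  have hvar : ∑ β, (M - 2 * S β) ^ 2 = 2 ^ Fintype.card C * M := by
    have e1 : ∀ β, (M - 2 * S β) ^ 2 =
        ∑ i ∈ E, ∑ j ∈ E, (1 - 2 * sep i β) * (1 - 2 * sep j β) := by
      intro β
      rw [← Finset.sum_mul_sum, sq]
      simp [hS, hM, Finset.mul_sum]
    simp only [e1]
    rw [Finset.sum_comm]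
    have e2 : ∀ i ∈ E, ∑ β, ∑ j ∈ E, (1 - 2 * sep i β) * (1 - 2 * sep j β) =
        2 ^ Fintype.card C := by
      intro i hi
      rw [Finset.sum_comm, Finset.sum_eq_single_of_mem i hi]
      · have : ∀ β, (1 - 2 * sep i β) * (1 - 2 * sep i β) = 1 := by
          intro β
          simp only [hsep]
          split_ifs <;> norm_num
        simp [this]
      · intro j hj hji
        have := sum_flip (e i) (fun β => (1 - 2 * sep i β) * (1 - 2 * sep j β))
        simp only [hflip i hi, hflip' i hi j hj hji.symm] at this
        have e3 : ∀ β, (1 - 2 * (1 - sep i β)) * (1 - 2 * sep j β) =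
          -((1 - 2 * sep i β) * (1 - 2 * sep j β)) := fun β => by ring
        simp only [e3, Finset.sum_neg_distrib] at this
        linarith
    rw [Finset.sum_congr rfl e2]
    simp [hM, mul_comm]
  set N : ℝ := 2 ^ Fintype.card C with hN
  have hNpos : 0 < N := by positivity
  have hcs : (∑ β, |M - 2 * S β|) ^ 2 ≤ N * (N * M) := by
    have := sq_sum_le_card_mul_sum_sq (s := (Finset.univ : Finset (C → Bool)))
      (f := fun β => |M - 2 * S β|)
    simp only [sq_abs] at this
    rw [hvar] at this
    simpa [hN] using this
  -- Both weights `S` and `M - S` are close to `M / 2`; the identity `key` turns the difference of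
  -- means into an integral against the centred count, which Cauchy–Schwarz controls.
  have hlin : M / 2 * (∑ β, H₁ β - ∑ β, H₀ β) =
      ∑ β, (M - 2 * S β) / 2 * (H₁ β + H₀ β) := by
    have : ∀ β, (M - 2 * S β) / 2 * (H₁ β + H₀ β) =
        M / 2 * H₁ β - M / 2 * H₀ β - (S β * H₁ β - (M - S β) * H₀ β) := fun β => by ring
    simp only [this, Finset.sum_sub_distrib, key, ← Finset.mul_sum]
    ring
  have habs : M / 2 * |∑ β, H₁ β - ∑ β, H₀ β| ≤ ∑ β, |M - 2 * S β| := by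
    have hM0 : 0 ≤ M / 2 := by positivity
    have habs0 : M / 2 * |∑ β, H₁ β - ∑ β, H₀ β| = |M / 2 * (∑ β, H₁ β - ∑ β, H₀ β)| := by
      rw [abs_mul, abs_of_nonneg hM0]
    rw [habs0, hlin]
    refine (Finset.abs_sum_le_sum_abs _ _).trans (Finset.sum_le_sum fun β _ => ?_)
    rw [abs_mul, abs_div, abs_two, abs_of_nonneg (add_nonneg (h1 β).1 (h0 β).1)]
    nlinarith [h1 β, h0 β, abs_nonneg (M - 2 * S β)]
  have hM0 : 0 < M := by
    by_contra hc
    nlinarith [sq_nonneg η]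
  set Δ := |∑ β, H₁ β - ∑ β, H₀ β| with hΔ
  have hΔ0 : 0 ≤ Δ := abs_nonneg _
  have h3 : (M / 2 * Δ) ^ 2 ≤ N * (N * M) := (pow_le_pow_left₀ (by positivity) habs 2).trans hcs
  have h4 : (M * Δ) ^ 2 ≤ (M * (η * N)) ^ 2 := by
    nlinarith [mul_le_mul_of_nonneg_left hE (by positivity : 0 ≤ N ^ 2 * M)]
  have h5 : Δ ≤ η * N := le_of_mul_le_mul_left (abs_le_of_sq_le_sq' h4 (by positivity)).2 hM0
  unfold coinMean
  rw [← sub_div, abs_div, abs_of_pos hNpos, div_le_iff₀ hNpos]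
  exact h5

end Smoothing

/-! ### Sample sequences, labels and exchangeable statistics. -/

/-- The positions of the samples: class `0` and `1` for training, class `2` for testing. -/
abbrev Pos (s : ℕ) : Type := Fin 3 × Fin s

/-- The domain, extended by a fresh element for every testing sample. -/
abbrev Ext (n s : ℕ) : Type := Fin n ⊕ Fin s

/-- Labels: a pair of elements, or a single element. -/
abbrev Lab (n k : ℕ) : Type := Fin k ⊕ Fin n

/-- Invariance under relabelling of the domain and reordering of each class of samples. -/
def Exchangeable {n s : ℕ} (F : (Pos s → Ext n s) → ℝ) : Prop :=
  ∀ (θ : Equiv.Perm (Ext n s)) (σ : Equiv.Perm (Pos s)), (∀ c, (σ c).1 = c.1) →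
    ∀ w, F (θ ∘ w ∘ σ) = F w

/-- Moving a collision from one pair of positions to another one of the same classes. -/
theorem Exchangeable.move_collision {n s : ℕ} {F : (Pos s → Ext n s) → ℝ} (hF : Exchangeable F)
    {w w' : Pos s → Ext n s} {a b c e : Pos s} {d d' z z' : Ext n s}
    (hab : a ≠ b) (hac : a ≠ c) (hae : a ≠ e) (hbc : b ≠ c) (hbe : b ≠ e) (hce : c ≠ e)
    (hac' : a.1 = c.1) (hbe' : b.1 = e.1)
    (hdd' : d ≠ d') (hdz' : d ≠ z') (hd'z : d' ≠ z) (hzz' : z ≠ z')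
    (wa : w a = d) (wb : w b = d) (wc : w c = z) (we : w e = z')
    (wa' : w' a = d) (wb' : w' b = d') (wc' : w' c = z) (we' : w' e = z)
    (hf : ∀ f, f ≠ a → f ≠ b → f ≠ c → f ≠ e →
      w' f = w f ∧ w f ≠ d ∧ w f ≠ d' ∧ w f ≠ z ∧ w f ≠ z') : F w = F w' := by
  -- Exchanging the positions `a` with `c` and `b` with `e` moves the collision; exchanging the
  -- values `d` with `z` and `z'` with `d'` restores the names.
  rw [← hF (Equiv.swap d z * Equiv.swap z' d') (Equiv.swap a c * Equiv.swap b e) ?_ w]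
  · congr 1
    funext f
    simp only [Function.comp_apply, Equiv.Perm.mul_apply]
    by_cases h1 : f = a
    · subst h1
      rw [Equiv.swap_apply_of_ne_of_ne hab hae, Equiv.swap_apply_left, wc, wa',
        Equiv.swap_apply_of_ne_of_ne hzz' hd'z.symm, Equiv.swap_apply_right]
    by_cases h2 : f = b
    · subst h2
      rw [Equiv.swap_apply_left, Equiv.swap_apply_of_ne_of_ne hae.symm hce.symm, we, wb',
        Equiv.swap_apply_left, Equiv.swap_apply_of_ne_of_ne hdd'.symm hd'z]
    by_cases h3 : f = c
    · subst h3
      rw [Equiv.swap_apply_of_ne_of_ne hbc.symm hce, Equiv.swap_apply_right, wa, wc',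
        Equiv.swap_apply_of_ne_of_ne hdz' hdd', Equiv.swap_apply_left]
    by_cases h4 : f = e
    · subst h4
      rw [Equiv.swap_apply_right, Equiv.swap_apply_of_ne_of_ne hab.symm hbc, wb, we',
        Equiv.swap_apply_of_ne_of_ne hdz' hdd', Equiv.swap_apply_left]
    obtain ⟨g1, g2, g3, g4, g5⟩ := hf f h1 h2 h3 h4
    rw [Equiv.swap_apply_of_ne_of_ne h2 h4, Equiv.swap_apply_of_ne_of_ne h1 h3,
      Equiv.swap_apply_of_ne_of_ne g5 g3, Equiv.swap_apply_of_ne_of_ne g2 g4, g1]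
  · intro f
    simp only [Equiv.Perm.mul_apply, Equiv.swap_apply_def]
    split_ifs <;> simp_all

/-! ### One hybrid step: restoring the true value of one testing sample. -/

section Hybrid

variable {n s k : ℕ} (u v : Fin k → Fin n) (D : Finset (Fin n))

/-- The element that a label and a coin produce. -/
def letter : Lab n k → Bool → Fin n
  | .inl i, b => if b then u i else v i
  | .inr z, _ => z

/-- The labels that can produce an element of the pair `i`. -/
def block (i : Fin k) : Finset (Lab n k) := {.inl i, .inr (u i), .inr (v i)}

/-- The letter at position `c`, where the testing samples with labels in `D` and index at least `j`
are replaced by fresh elements. -/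
def hybridLetter (j : ℕ) (c : Pos s) (x : Lab n k) (b : Bool) : Ext n s :=
  if c.1 = 2 ∧ j ≤ c.2 ∧ x ∈ D.image Sum.inr then .inr c.2 else .inl (letter u v x b)

/-- The sample sequence made of the hybrid letters. -/
def hybrid (j : ℕ) (l : Pos s → Lab n k) (β : Pos s → Bool) (c : Pos s) : Ext n s :=
  hybridLetter u v D j c (l c) (β c)

/-- The pairs of a position of class `κ` and a testing position. -/
def classPairs (s : ℕ) (κ : Fin 3) : Finset (Pos s × Pos s) :=
  Finset.univ.filter fun p => p.1.1 = κ ∧ p.2.1 = 2 ∧ (κ = 2 → p.1.2 < p.2.2)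

/-- The pairs of elements hit by exactly one sample of class `κ` and one testing sample. -/
def hitPairs (κ : Fin 3) (l : Pos s → Lab n k) : Finset (Fin k) :=
  Finset.univ.filter fun i => ∃ p ∈ classPairs s κ, soleHit (block u v i) (.inl i) p.1 p.2 l = 1

/-- Some testing sample falls together with two further samples on an element of `D`. -/
def TripleIn (l : Pos s → Lab n k) : Prop :=
  ∃ q : Fin s, ∃ a b : Pos s, a ≠ (2, q) ∧ b ≠ (2, q) ∧ a ≠ b ∧
    ∃ d ∈ D, l (2, q) = .inr d ∧ l a = .inr d ∧ l b = .inr d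

variable {u v D}

theorem classPairs_ne {κ : Fin 3} : ∀ p ∈ classPairs s κ, p.1 ≠ p.2 := by
  rintro ⟨a, b⟩ hp hab
  simp only [classPairs, Finset.mem_filter, Finset.mem_univ, true_and] at hp hab
  subst hab
  exact lt_irrefl _ (hp.2.2 (hp.1.symm.trans hp.2.1))

theorem classPairs_swap {κ : Fin 3} : ∀ p ∈ classPairs s κ, (p.2, p.1) ∉ classPairs s κ := by
  rintro ⟨a, b⟩ hp hab
  simp only [classPairs, Finset.mem_filter, Finset.mem_univ, true_and] at hp hab
  have h2 : κ = 2 := hab.1.symm.trans hp.2.1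
  exact lt_asymm (hp.2.2 h2) (hab.2.2 h2)

theorem hybridLetter_succ {j : ℕ} {c : Pos s} (h : ¬(c.1 = 2 ∧ (c.2 : ℕ) = j)) (x : Lab n k)
    (b : Bool) : hybridLetter u v D (j + 1) c x b = hybridLetter u v D j c x b := by
  unfold hybridLetter
  congr 1
  refine propext ⟨fun ⟨h1, h2, h3⟩ => ⟨h1, by omega, h3⟩, fun ⟨h1, h2, h3⟩ => ⟨h1, ?_, h3⟩⟩
  have : (c.2 : ℕ) ≠ j := fun h' => h ⟨h1, h'⟩
  omega

/-- Replacing one fresh testing sample by its real value changes the mean of an exchangeable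
statistic only if this value is hit by another sample, and then by little. -/
theorem abs_hybrid_step_le {F : (Pos s → Ext n s) → ℝ} (hF : Exchangeable F)
    (hF01 : ∀ w, 0 ≤ F w ∧ F w ≤ 1)
    (huv : Function.Injective (Sum.elim u v)) (hu : ∀ i, u i ∉ D) (hv : ∀ i, v i ∉ D)
    {l : Pos s → Lab n k} (hl : ¬TripleIn D l) {η : ℝ} (hη : 0 ≤ η)
    (hE : 1 ≤ η ∨ ∀ κ, 4 ≤ η ^ 2 * (hitPairs u v κ l).card) (q : Fin s) :
    |coinMean (fun β => F (hybrid u v D (q + 1) l β)) - coinMean (fun β => F (hybrid u v D q l β))| ≤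
      η * ∑ c : Pos s, if c ≠ (2, q) ∧ ∃ d ∈ D, l (2, q) = .inr d ∧ l c = .inr d then 1 else 0 := by
  have hne : ∀ c : Pos s, c ≠ (2, q) → ∀ β,
      hybrid u v D (q + 1) l β c = hybrid u v D q l β c := by
    intro c hc β
    refine hybridLetter_succ (fun h => hc ?_) _ _
    exact Prod.ext h.1 (Fin.ext h.2)
  have hnn : (0 : ℝ) ≤ ∑ c : Pos s,
      if c ≠ (2, q) ∧ ∃ d ∈ D, l (2, q) = .inr d ∧ l c = .inr d then 1 else 0 :=
    Finset.sum_nonneg fun c _ => by split_ifs <;> norm_num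
  by_cases hq : l (2, q) ∈ D.image Sum.inr
  swap
  · have : ∀ β, hybrid u v D (q + 1) l β = hybrid u v D q l β := by
      intro β
      funext c
      by_cases hc : c = (2, q)
      · subst hc
        simp [hybrid, hybridLetter, -Finset.mem_image, hq]
      · exact hne c hc β
    simp only [this, sub_self, abs_zero]
    positivity
  obtain ⟨d, hd, hqd⟩ := Finset.mem_image.1 hq
  have hq1 : ∀ β, hybrid u v D (q + 1) l β (2, q) = .inl d := by
    intro β
    simp [hybrid, hybridLetter, ← hqd, letter]
  have hq0 : ∀ β, hybrid u v D q l β (2, q) = .inr q := by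
    intro β
    simp only [hybrid, hybridLetter]
    rw [if_pos ⟨trivial, le_rfl, hq⟩]
  have hfresh : ∀ c : Pos s, c ≠ (2, q) → ∀ β, hybrid u v D q l β c ≠ .inr q := by
    intro c hc β h
    simp only [hybrid, hybridLetter] at h
    split_ifs at h with h1
    exact hc (Prod.ext h1.1 (Sum.inr.inj h))
  have hval : ∀ c β, hybrid u v D q l β c = .inl d → l c = .inr d := by
    intro c β h
    simp only [hybrid, hybridLetter] at h
    split_ifs at h with h1
    have h2 := Sum.inl.inj h
    rcases hlc : l c with i | z
    · rw [hlc] at h2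
      simp only [letter] at h2
      split_ifs at h2
      · exact absurd hd (h2 ▸ hu i)
      · exact absurd hd (h2 ▸ hv i)
    · rw [hlc] at h2
      simp only [letter] at h2
      rw [h2]
  -- A testing sample alone on `d` is as good as fresh: swapping `d` with the fresh element relates
  -- the two hybrids.
  by_cases hocc : ∃ a, a ≠ (2, q) ∧ l a = .inr d
  swap
  · push Not at hocc
    have : ∀ β, F (hybrid u v D (q + 1) l β) = F (hybrid u v D q l β) := by
      intro β
      rw [← hF (Equiv.swap (.inl d) (.inr q)) 1 (fun _ => rfl) (hybrid u v D q l β)]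
      congr 1
      funext c
      simp only [Function.comp_apply, Equiv.Perm.one_apply]
      by_cases hc : c = (2, q)
      · subst hc
        rw [hq1, hq0, Equiv.swap_apply_right]
      · rw [hne c hc, Equiv.swap_apply_of_ne_of_ne _ (hfresh c hc β)]
        exact fun h => hocc c hc (hval c β h)
    simp only [this, sub_self, abs_zero]
    positivity
  obtain ⟨a, haq, had⟩ := hocc
  have hone : (1 : ℝ) ≤ ∑ c : Pos s,
      if c ≠ (2, q) ∧ ∃ d ∈ D, l (2, q) = .inr d ∧ l c = .inr d then 1 else 0 := by
    refine le_trans ?_ (Finset.single_le_sum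
      (f := fun c : Pos s => if c ≠ (2, q) ∧ ∃ d ∈ D, l (2, q) = .inr d ∧ l c = .inr d
        then (1 : ℝ) else 0) (fun c _ => by split_ifs <;> norm_num) (Finset.mem_univ a))
    rw [if_pos ⟨haq, d, hd, hqd.symm, had⟩]
  refine le_trans ?_ (le_mul_of_one_le_right hη hone)
  have huniq : ∀ c, c ≠ a → c ≠ (2, q) → l c ≠ .inr d := fun c hca hcq hc =>
    hl ⟨q, a, c, haq, hcq, hca.symm, d, hd, hqd.symm, had, hc⟩
  rcases hE with hE | hE
  · rw [← coinMean_sub]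
    refine le_trans (coinMean_abs_le (b := 1) fun β => ?_) hE
    have h1 := hF01 (hybrid u v D (q + 1) l β)
    have h2 := hF01 (hybrid u v D q l β)
    rw [abs_le]
    constructor <;> linarith [h1.1, h1.2, h2.1, h2.2]
  -- If `a` does not show `d`, it is a later testing sample, itself still replaced by a fresh
  -- element; then `d` again occurs only at position `(2, q)`, and relabelling suffices.
  by_cases hal : ∀ β, hybrid u v D q l β a = .inl d
  swap
  · push Not at hal
    obtain ⟨β₀, hβ₀⟩ := hal
    have hac : a.1 = 2 ∧ (q : ℕ) ≤ a.2 := by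
      by_contra hc
      apply hβ₀
      simp only [hybrid, hybridLetter]
      rw [if_neg (fun h => hc ⟨h.1, h.2.1⟩), had]
      rfl
    have : ∀ β, F (hybrid u v D (q + 1) l β) = F (hybrid u v D q l β) := by
      intro β
      rw [← hF (Equiv.swap (.inl d) (.inr q)) 1 (fun _ => rfl) (hybrid u v D q l β)]
      congr 1
      funext c
      simp only [Function.comp_apply, Equiv.Perm.one_apply]
      by_cases hc : c = (2, q)
      · subst hc
        rw [hq1, hq0, Equiv.swap_apply_right]
      · rw [hne c hc, Equiv.swap_apply_of_ne_of_ne _ (hfresh c hc β)]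
        intro h
        have hca : c = a := by
          by_contra hca
          exact huniq c hca hc (hval c β h)
        subst hca
        simp only [hybrid, hybridLetter] at h
        rw [if_pos ⟨hac.1, hac.2, Finset.mem_image.2 ⟨d, hd, had.symm⟩⟩] at h
        exact absurd h (by simp)
    simp only [this, sub_self, abs_zero]
    exact hη
  have hP : ∀ i ∈ hitPairs u v a.1 l, ∃ p : Pos s × Pos s, p.1.1 = a.1 ∧ p.2.1 = 2 ∧ p.1 ≠ p.2 ∧
      l p.1 = .inl i ∧ l p.2 = .inl i ∧ ∀ c, c ≠ p.1 → c ≠ p.2 → l c ∉ block u v i := by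
    intro i hi
    obtain ⟨p, hp, hp1⟩ := (Finset.mem_filter.1 hi).2
    refine ⟨p, (Finset.mem_filter.1 hp).2.1, (Finset.mem_filter.1 hp).2.2.1, classPairs_ne p hp, ?_⟩
    rcases soleHit_eq_one_or_zero (block u v i) (.inl i) p.1 p.2 l with ⟨-, h⟩ | h
    · exact h
    · rw [h] at hp1
      exact absurd hp1 zero_ne_one
  have : Nonempty (Pos s × Pos s) := ⟨(a, a)⟩
  choose! p hp1 hp2 hp3 hp4 hp5 hp6 using hP
  -- The hiding pairs have the class of `a`, so positions may be exchanged within classes. A true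
  -- collision at `d` beside a separated pair becomes a fresh value beside a coinciding pair once
  -- the coin of the testing sample is reversed.
  refine abs_coinMean_sub_le (hitPairs u v a.1 l) (fun i => (p i).2) (fun i => (p i).1)
    (fun i hi j hj hij h => hij ?_) (fun i hi j hj h => ?_) (fun β => hF01 _) (fun β => hF01 _)
    (fun i hi β hβ => ?_) hη (hE a.1)
  · have := hp5 i hi
    rw [h, hp5 j hj] at this
    exact (Sum.inl.inj this).symm
  · by_cases hij : i = j
    · subst hij
      exact hp3 i hi h
    · have := hp4 i hi
      rw [h, hp5 j hj] at this
      exact hij (Sum.inl.inj this).symm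
  have hpair : ∀ (c : Pos s) (j : ℕ) (β : Pos s → Bool), l c = .inl i →
      hybrid u v D j l β c = .inl (if β c then u i else v i) := by
    intro c j β hc
    simp [hybrid, hybridLetter, hc, letter]
  have hui : u i ≠ v i := fun h => by
    have := @huv (.inl i) (.inr i) h
    simp at this
  have hite' : ∀ x y : Bool, x ≠ y → (if x then u i else v i) ≠ if y then u i else v i := by
    rintro (_ | _) (_ | _) h <;> simp [hui, hui.symm] at h ⊢
  have hnot : ∀ x y : Bool, x ≠ y → (!y) = x := by decide
  set c := (p i).1 with hc
  set e := (p i).2 with he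
  have hlc := hp4 i hi
  have hle := hp5 i hi
  have hce := hp3 i hi
  have hlq : l (2, q) = .inr d := hqd.symm
  have nl : ∀ {x y : Pos s}, l x = .inr d → l y = .inl i → x ≠ y := by
    intro x y hx hy hxy
    rw [hxy, hy] at hx
    simp at hx
  have hdu : d ≠ u i := fun h => hu i (h ▸ hd)
  have hdv : d ≠ v i := fun h => hv i (h ▸ hd)
  have hz : ∀ b : Bool, d ≠ if b then u i else v i := by
    intro b
    split_ifs
    exacts [hdu, hdv]
  have hflip : ∀ x, x ≠ e → hybrid u v D q l (flip e β) x = hybrid u v D q l β x := by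
    intro x hx
    simp only [hybrid, flip_of_ne hx]
  refine hF.move_collision (a := a) (b := (2, q)) (c := c) (e := e) (d := .inl d) (d' := .inr q)
    (z := .inl (if β c then u i else v i)) (z' := .inl (if β e then u i else v i))
    haq (nl had hlc) (nl had hle) (nl hlq hlc) (nl hlq hle) hce (hp1 i hi).symm (hp2 i hi).symm
    (by simp) (fun h => hz _ (Sum.inl.inj h)) (by simp)
    ?_ ?_ (hq1 β) (hpair c _ β hlc) (hpair e _ β hle) (hal _) (hq0 _) ?_ ?_ ?_
  · intro h
    exact hite' _ _ hβ (Sum.inl.inj h)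
  · rw [hne a haq, hal]
  · rw [hpair c _ _ hlc, flip_of_ne hce]
  · rw [hpair e _ _ hle, flip_self, hnot _ _ hβ]
  · intro f hfa hfq hfc hfe
    have hblk : ∀ y, y = u i ∨ y = v i → hybrid u v D q l β f ≠ .inl y := by
      intro y hy h
      apply hp6 i hi f hfc hfe
      simp only [hybrid, hybridLetter] at h
      split_ifs at h with h1
      have h2 := Sum.inl.inj h
      rcases hlf : l f with i' | z
      · have h3 : Sum.elim u v (if β f then .inl i' else .inr i') = y := by
          rw [hlf] at h2
          rw [← h2]
          cases β f <;> rfl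
        have h4 : i' = i := by
          rcases hy with hy | hy
          · have := @huv _ (.inl i) (h3.trans hy)
            split_ifs at this
            exact Sum.inl.inj this
          · have := @huv _ (.inr i) (h3.trans hy)
            split_ifs at this
            exact Sum.inr.inj this
        simp [block, h4]
      · rw [hlf] at h2
        simp only [letter] at h2
        rcases hy with hy | hy <;> simp [block, h2, hy]
    have hite : ∀ b : Bool, (if b then u i else v i) = u i ∨ (if b then u i else v i) = v i := by
      rintro (_ | _) <;> simp
    rw [hne f hfq, hflip f hfe]
    exact ⟨rfl, fun h => huniq f hfa hfq (hval f β h), hfresh f hfq β, hblk _ (hite _), hblk _ (hite _)⟩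

end Hybrid

/-! ### The two-stage law: labels with fair coins, and their masses. -/

section Coins

variable {C Λ : Type*} [Fintype C] [DecidableEq C] [Fintype Λ] [DecidableEq Λ]

/-- Averaging over labels with fair coins attached. -/
theorem expect_coins (m : C → Λ → ℝ) (G : (C → Λ × Bool) → ℝ) :
    expect (fun c (x : Λ × Bool) => m c x.1 / 2) G =
      expect m (fun l => coinMean fun β => G fun c => (l c, β c)) := by
  unfold expect coinMean
  rw [← Equiv.sum_comp (Equiv.arrowProdEquivProdArrow C (fun _ => Λ) (fun _ => Bool)).symm,
    Fintype.sum_prod_type]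
  refine Finset.sum_congr rfl fun l _ => ?_
  dsimp only
  rw [Finset.sum_div, Finset.mul_sum]
  refine Finset.sum_congr rfl fun β _ => ?_
  simp only [Equiv.arrowProdEquivProdArrow, Equiv.coe_fn_symm_mk, Finset.prod_div_distrib,
    Finset.prod_const, Finset.card_univ]
  ring

end Coins

section Mass

variable {n k : ℕ} (u v : Fin k → Fin n)

/-- The law of the label of a sample from `w`. -/
def labelMass (w : Fin n → ℝ) : Lab n k → ℝ
  | .inl i => 2 * w (v i)
  | .inr z => w z - ∑ i, ((if u i = z then w (v i) else 0) + if v i = z then w (v i) else 0)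

variable {u v} {w : Fin n → ℝ}

theorem labelMass_inr_of_ne {z : Fin n} (hu : ∀ i, u i ≠ z) (hv : ∀ i, v i ≠ z) :
    labelMass u v w (.inr z) = w z := by
  simp [labelMass, hu, hv]

theorem labelMass_left (huv : Function.Injective (Sum.elim u v)) (i : Fin k) :
    labelMass u v w (.inr (u i)) = w (u i) - w (v i) := by
  have h1 : ∀ j, u j = u i ↔ j = i :=
    fun j => ⟨fun h => Sum.inl.inj (@huv (.inl j) (.inl i) h), fun h => by rw [h]⟩
  have h2 : ∀ j, v j ≠ u i := fun j h => by simpa using @huv (.inr j) (.inl i) h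
  simp [labelMass, h1, h2]

theorem labelMass_right (huv : Function.Injective (Sum.elim u v)) (i : Fin k) :
    labelMass u v w (.inr (v i)) = 0 := by
  have h1 : ∀ j, v j = v i ↔ j = i :=
    fun j => ⟨fun h => Sum.inr.inj (@huv (.inr j) (.inr i) h), fun h => by rw [h]⟩
  have h2 : ∀ j, u j ≠ v i := fun j h => by simpa using @huv (.inl j) (.inr i) h
  simp [labelMass, h1, h2]

theorem labelMass_nonneg (huv : Function.Injective (Sum.elim u v)) (hw : ∀ z, 0 ≤ w z)
    (hle : ∀ i, w (v i) ≤ w (u i)) (x : Lab n k) : 0 ≤ labelMass u v w x := by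
  rcases x with i | z
  · simp only [labelMass]
    linarith [hw (v i)]
  · by_cases h1 : ∃ i, u i = z
    · obtain ⟨i, rfl⟩ := h1
      rw [labelMass_left huv]
      linarith [hle i]
    · by_cases h2 : ∃ i, v i = z
      · obtain ⟨i, rfl⟩ := h2
        rw [labelMass_right huv]
      · push Not at h1 h2
        rw [labelMass_inr_of_ne h1 h2]
        exact hw z

theorem sum_labelMass : ∑ x, labelMass u v w x = ∑ z, w z := by
  simp only [labelMass, Fintype.sum_sum_type, Finset.sum_sub_distrib]
  rw [Finset.sum_comm]
  simp only [Finset.sum_add_distrib, Finset.sum_ite_eq, Finset.mem_univ, if_true]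
  rw [← Finset.mul_sum]
  ring

/-- A pair label carries twice the smaller mass, so its coin returns `w (v i)` to each element of
the pair, exactly what was taken off the two single labels. -/
theorem map_labelMass (z : Fin n) :
    w z = ∑ x : Lab n k × Bool, if letter u v x.1 x.2 = z then labelMass u v w x.1 / 2 else 0 := by
  have h : ∀ x : Fin n, (∑ b : Bool, if letter u v (.inr x : Lab n k) b = z then
      labelMass u v w (.inr x) / 2 else 0) = if x = z then labelMass u v w (.inr z) else 0 := by
    intro x
    by_cases h : x = z
    · simp only [letter, h, if_true, Fintype.sum_bool]
      ring
    · simp [letter, h]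
  rw [Fintype.sum_prod_type, Fintype.sum_sum_type, Finset.sum_congr rfl fun x _ => h x]
  simp only [Finset.sum_ite_eq', Finset.mem_univ, if_true, Fintype.sum_bool, letter, labelMass]
  simp

theorem sum_compl_block (huv : Function.Injective (Sum.elim u v)) (i : Fin k) :
    ∑ x, (if x ∈ block u v i then 0 else labelMass u v w x) =
      ∑ z, w z - (w (u i) + w (v i)) := by
  have hui : u i ≠ v i := fun h => by simpa using @huv (.inl i) (.inr i) h
  have h1 : ∑ x ∈ block u v i, labelMass u v w x = w (u i) + w (v i) := by
    rw [block, Finset.sum_insert (by simp), Finset.sum_pair (by simpa using hui),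
      labelMass_left huv, labelMass_right huv]
    simp only [labelMass]
    ring
  have h2 : ∀ x, (if x ∈ block u v i then 0 else labelMass u v w x) =
      labelMass u v w x - if x ∈ block u v i then labelMass u v w x else 0 := by
    intro x
    split_ifs <;> ring
  simp only [h2, Finset.sum_sub_distrib, sum_labelMass, Finset.sum_ite_mem, Finset.univ_inter, h1]

theorem block_disjoint (huv : Function.Injective (Sum.elim u v)) {i j : Fin k} (hij : i ≠ j) :
    Disjoint (block u v i) (block u v j) := by
  have h1 : u i ≠ u j := fun h => hij (Sum.inl.inj (@huv (.inl i) (.inl j) h))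
  have h2 : v i ≠ v j := fun h => hij (Sum.inr.inj (@huv (.inr i) (.inr j) h))
  have h3 : u i ≠ v j := fun h => by simpa using @huv (.inl i) (.inr j) h
  have h4 : v i ≠ u j := fun h => by simpa using @huv (.inr i) (.inl j) h
  simp [block, hij.symm, h1.symm, h2.symm, h3.symm, h4.symm]

end Mass

/-! ### Summing the hybrid steps; expected collisions and triples. -/

section Hybrids

variable {n s k : ℕ} {u v : Fin k → Fin n} {D : Finset (Fin n)}

/-- The number of collisions of a testing sample with another sample inside `D`. -/
def collisions (D : Finset (Fin n)) (l : Pos s → Lab n k) : ℝ :=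
  ∑ q : Fin s, ∑ c : Pos s,
    if c ≠ (2, q) ∧ ∃ d ∈ D, l (2, q) = .inr d ∧ l c = .inr d then 1 else 0

theorem collisions_nonneg (l : Pos s → Lab n k) : 0 ≤ collisions D l :=
  Finset.sum_nonneg fun q _ => Finset.sum_nonneg fun c _ => by split_ifs <;> norm_num

theorem abs_hybrid_le {F : (Pos s → Ext n s) → ℝ} (hF : Exchangeable F)
    (hF01 : ∀ w, 0 ≤ F w ∧ F w ≤ 1)
    (huv : Function.Injective (Sum.elim u v)) (hu : ∀ i, u i ∉ D) (hv : ∀ i, v i ∉ D)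
    {l : Pos s → Lab n k} (hl : ¬TripleIn D l) {η : ℝ} (hη : 0 ≤ η)
    (hE : 1 ≤ η ∨ ∀ κ, 4 ≤ η ^ 2 * (hitPairs u v κ l).card) :
    |coinMean (fun β => F (hybrid u v D s l β)) - coinMean (fun β => F (hybrid u v D 0 l β))| ≤
      η * collisions D l := by
  rw [← Finset.sum_range_sub (fun j => coinMean fun β => F (hybrid u v D j l β)) s,
    ← Fin.sum_univ_eq_sum_range (fun j => coinMean (fun β => F (hybrid u v D (j + 1) l β)) -
      coinMean (fun β => F (hybrid u v D j l β))) s, collisions, Finset.mul_sum]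
  exact (Finset.abs_sum_le_sum_abs _ _).trans (Finset.sum_le_sum fun q _ =>
    abs_hybrid_step_le hF hF01 huv hu hv hl hη hE q)

-- Conditionally on the labels, the trivial bound 1 is used on triples and on the exceptional event
-- `B`; elsewhere the telescoped hybrid steps give `η` per collision.
open Classical in
theorem abs_expect_hybrid_le {F : (Pos s → Ext n s) → ℝ} (hF : Exchangeable F)
    (hF01 : ∀ w, 0 ≤ F w ∧ F w ≤ 1)
    (huv : Function.Injective (Sum.elim u v)) (hu : ∀ i, u i ∉ D) (hv : ∀ i, v i ∉ D)
    {m : Pos s → Lab n k → ℝ} (hm : ∀ c x, 0 ≤ m c x) {η : ℝ} (hη : 0 ≤ η)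
    (B : (Pos s → Lab n k) → Prop)
    (hB : ∀ l, ¬B l → 1 ≤ η ∨ ∀ κ, 4 ≤ η ^ 2 * (hitPairs u v κ l).card) :
    |expect m (fun l => coinMean fun β => F (hybrid u v D s l β)) -
      expect m (fun l => coinMean fun β => F (hybrid u v D 0 l β))| ≤
      expect m (fun l => if TripleIn D l then 1 else 0) + expect m (fun l => if B l then 1 else 0) +
        η * expect m (collisions D) := by
  rw [← expect_sub, ← expect_const_mul, ← expect_add, ← expect_add]
  refine (abs_expect_le hm _).trans (expect_mono hm fun l => ?_)
  have h1 : |coinMean (fun β => F (hybrid u v D s l β)) -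
      coinMean (fun β => F (hybrid u v D 0 l β))| ≤ 1 := by
    rw [← coinMean_sub]
    refine coinMean_abs_le fun β => ?_
    have h1 := hF01 (hybrid u v D s l β)
    have h2 := hF01 (hybrid u v D 0 l β)
    rw [abs_le]
    constructor <;> linarith [h1.1, h1.2, h2.1, h2.2]
  have h2 : 0 ≤ η * collisions D l := mul_nonneg hη (collisions_nonneg l)
  by_cases h3 : TripleIn D l
  · rw [if_pos h3]
    have : (0 : ℝ) ≤ if B l then 1 else 0 := by split_ifs <;> norm_num
    linarith
  · by_cases h4 : B l
    · rw [if_neg h3, if_pos h4]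
      linarith
    · rw [if_neg h3, if_neg h4, zero_add, zero_add]
      exact abs_hybrid_le hF hF01 huv hu hv h3 hη (hB l h4)

-- A union bound over positions and over `D`. The case `c = (2, q)` contributes nothing but is kept
-- in the bound so that the sum factorizes.
open Classical in
theorem expect_collisions_le {m : Pos s → Lab n k → ℝ} (hm : ∀ c x, 0 ≤ m c x)
    (hm1 : ∀ c, ∑ x, m c x = 1) {W : Fin 3 → Fin n → ℝ}
    (hW : ∀ c, ∀ d ∈ D, m c (.inr d) = W c.1 d) :
    expect m (collisions D) ≤ s ^ 2 * ∑ d ∈ D, W 2 d * (W 0 d + W 1 d + W 2 d) := by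
  have h1 : ∀ (q : Fin s) (c : Pos s), expect m (fun l =>
      if c ≠ (2, q) ∧ ∃ d ∈ D, l (2, q) = .inr d ∧ l c = .inr d then 1 else 0) ≤
      ∑ d ∈ D, W 2 d * W c.1 d := by
    intro q c
    have hnn : ∀ c : Pos s, ∀ d ∈ D, 0 ≤ W c.1 d := fun c d hd => hW c d hd ▸ hm c _
    by_cases hc : c = (2, q)
    · simp only [hc, ne_eq, not_true_eq_false, false_and, if_false, expect_const hm1]
      exact Finset.sum_nonneg fun d hd => mul_nonneg (hnn (2, q) d hd) (hnn (2, q) d hd)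
    · have h2 : ∀ d ∈ D, W 2 d * W c.1 d = expect m (fun l =>
          if ∀ x ∈ ({(2, q), c} : Finset (Pos s)), l x = .inr d then 1 else 0) := by
        intro d hd
        rw [expect_cylinder hm1, Finset.prod_pair (Ne.symm hc), hW _ d hd, hW _ d hd]
      rw [Finset.sum_congr rfl h2, ← expect_sum]
      refine expect_mono hm fun l => ?_
      split_ifs with h3
      · obtain ⟨-, d, hd, h4, h5⟩ := h3
        refine le_trans ?_ (Finset.single_le_sum (fun d _ => ?_) hd)
        · rw [if_pos (by simp [h4, h5])]
        · split_ifs <;> norm_num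
      · exact Finset.sum_nonneg fun d _ => by split_ifs <;> norm_num
  unfold collisions
  rw [expect_sum]
  simp only [expect_sum]
  refine (Finset.sum_le_sum fun q _ => Finset.sum_le_sum fun c _ => h1 q c).trans (le_of_eq ?_)
  simp only [Finset.sum_const, Finset.card_univ, Fintype.card_fin, nsmul_eq_mul]
  rw [Finset.sum_comm, Finset.mul_sum, Finset.mul_sum]
  refine Finset.sum_congr rfl fun d _ => ?_
  rw [← Finset.mul_sum, Fintype.sum_prod_type, Fin.sum_univ_three]
  simp only [Finset.sum_const, Finset.card_univ, Fintype.card_fin, nsmul_eq_mul]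
  ring

open Classical in
theorem expect_tripleIn_le {m : Pos s → Lab n k → ℝ} (hm : ∀ c x, 0 ≤ m c x)
    (hm1 : ∀ c, ∑ x, m c x = 1) {W : Fin 3 → Fin n → ℝ}
    (hW : ∀ c, ∀ d ∈ D, m c (.inr d) = W c.1 d) :
    expect m (fun l => if TripleIn D l then 1 else 0) ≤
      s ^ 3 * ∑ d ∈ D, W 2 d * (W 0 d + W 1 d + W 2 d) ^ 2 := by
  have hnn : ∀ c : Pos s, ∀ d ∈ D, 0 ≤ W c.1 d := fun c d hd => hW c d hd ▸ hm c _
  have h1 : ∀ l : Pos s → Lab n k, (if TripleIn D l then (1 : ℝ) else 0) ≤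
      ∑ q : Fin s, ∑ a : Pos s, ∑ b : Pos s, ∑ d ∈ D,
        if (a ≠ (2, q) ∧ b ≠ (2, q) ∧ a ≠ b) ∧
          ∀ x ∈ ({(2, q), a, b} : Finset (Pos s)), l x = .inr d then 1 else 0 := by
    intro l
    have h0 : ∀ (q : Fin s) (a b : Pos s) (d : Fin n),
        (0 : ℝ) ≤ if (a ≠ (2, q) ∧ b ≠ (2, q) ∧ a ≠ b) ∧
          ∀ x ∈ ({(2, q), a, b} : Finset (Pos s)), l x = .inr d then 1 else 0 := by
      intro q a b d
      split_ifs <;> norm_num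
    split_ifs with h
    · obtain ⟨q, a, b, haq, hbq, hab, d, hd, h2, h3, h4⟩ := h
      refine le_trans ?_ (Finset.single_le_sum (fun q _ => Finset.sum_nonneg fun a _ =>
        Finset.sum_nonneg fun b _ => Finset.sum_nonneg fun d _ => h0 q a b d) (Finset.mem_univ q))
      refine le_trans ?_ (Finset.single_le_sum (fun a _ =>
        Finset.sum_nonneg fun b _ => Finset.sum_nonneg fun d _ => h0 q a b d) (Finset.mem_univ a))
      refine le_trans ?_ (Finset.single_le_sum (fun b _ =>
        Finset.sum_nonneg fun d _ => h0 q a b d) (Finset.mem_univ b))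
      refine le_trans ?_ (Finset.single_le_sum (fun d _ => h0 q a b d) hd)
      rw [if_pos ⟨⟨haq, hbq, hab⟩, by simp [h2, h3, h4]⟩]
    · exact Finset.sum_nonneg fun q _ => Finset.sum_nonneg fun a _ =>
        Finset.sum_nonneg fun b _ => Finset.sum_nonneg fun d _ => h0 q a b d
  refine (expect_mono hm h1).trans ?_
  simp only [expect_sum]
  have h2 : ∀ (q : Fin s) (a b : Pos s), ∀ d ∈ D, expect m (fun l =>
      if (a ≠ (2, q) ∧ b ≠ (2, q) ∧ a ≠ b) ∧
          ∀ x ∈ ({(2, q), a, b} : Finset (Pos s)), l x = .inr d then 1 else 0) ≤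
      W 2 d * (W a.1 d * W b.1 d) := by
    intro q a b d hd
    by_cases h3 : a ≠ (2, q) ∧ b ≠ (2, q) ∧ a ≠ b
    · have h4 : (2, q) ∉ ({a, b} : Finset (Pos s)) := by
        simp [Ne.symm h3.1, Ne.symm h3.2.1]
      refine le_of_eq (Eq.trans ?_ ((expect_cylinder hm1 {(2, q), a, b} (.inr d)).trans ?_))
      · exact congrArg (expect m) (funext fun l => if_congr (and_iff_right h3) rfl rfl)
      · rw [Finset.prod_insert h4, Finset.prod_pair h3.2.2, hW _ d hd, hW _ d hd, hW _ d hd]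
    · simp only [h3, false_and, if_false, expect_const hm1]
      exact mul_nonneg (hnn (2, q) d hd) (mul_nonneg (hnn a d hd) (hnn b d hd))
  refine (Finset.sum_le_sum fun q _ => Finset.sum_le_sum fun a _ => Finset.sum_le_sum fun b _ =>
    Finset.sum_le_sum fun d hd => h2 q a b d hd).trans (le_of_eq ?_)
  have hS : ∀ d, ∑ c : Pos s, W c.1 d = s * (W 0 d + W 1 d + W 2 d) := by
    intro d
    rw [Fintype.sum_prod_type, Fin.sum_univ_three]
    simp only [Finset.sum_const, Finset.card_univ, Fintype.card_fin, nsmul_eq_mul]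
    ring
  have hS2 : ∑ a : Pos s, ∑ b : Pos s, ∑ d ∈ D, W 2 d * (W a.1 d * W b.1 d) =
      ∑ d ∈ D, W 2 d * (s * (W 0 d + W 1 d + W 2 d)) ^ 2 := by
    rw [Finset.sum_congr rfl fun a _ => Finset.sum_comm, Finset.sum_comm]
    refine Finset.sum_congr rfl fun d _ => ?_
    rw [← hS, sq, Finset.sum_mul_sum, Finset.mul_sum]
    exact Finset.sum_congr rfl fun a _ => (Finset.mul_sum _ _ _).symm
  rw [hS2, Finset.sum_const, Finset.card_univ, Fintype.card_fin, nsmul_eq_mul, Finset.mul_sum,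
    Finset.mul_sum]
  exact Finset.sum_congr rfl fun d _ => by ring

end Hybrids

/-! ### Pairing the common elements. -/

/-- Greedy pairing of elements in decreasing order: the smaller elements of the pairs carry at
least half of the squared norm, up to the largest element. -/
theorem exists_pairing {n : ℕ} (p : Fin n → ℝ) (hp : ∀ z, 0 ≤ p z) (S : Finset (Fin n)) :
    ∀ b : ℝ, (∀ z ∈ S, p z ≤ b) → ∃ (k : ℕ) (u v : Fin k → Fin n),
      Function.Injective (Sum.elim u v) ∧ (∀ i, u i ∈ S) ∧ (∀ i, v i ∈ S) ∧
        (∀ i, p (v i) ≤ p (u i)) ∧ ∑ z ∈ S, p z ^ 2 - b ^ 2 ≤ 2 * ∑ i, p (v i) ^ 2 := by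
  induction S using Finset.strongInduction with
  | H S ih =>
  intro b hb
  have htriv : ∑ z ∈ S, p z ^ 2 - b ^ 2 ≤ 0 → ∃ (k : ℕ) (u v : Fin k → Fin n),
      Function.Injective (Sum.elim u v) ∧ (∀ i, u i ∈ S) ∧ (∀ i, v i ∈ S) ∧
        (∀ i, p (v i) ≤ p (u i)) ∧ ∑ z ∈ S, p z ^ 2 - b ^ 2 ≤ 2 * ∑ i, p (v i) ^ 2 := fun h =>
    ⟨0, Fin.elim0, Fin.elim0, fun x => by rcases x with x | x <;> exact x.elim0,
      fun i => i.elim0, fun i => i.elim0, fun i => i.elim0, by simpa using h⟩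
  rcases S.eq_empty_or_nonempty with rfl | hS
  · exact htriv (by simpa using sq_nonneg b)
  obtain ⟨y, hy, hymax⟩ := S.exists_max_image p hS
  rcases (S.erase y).eq_empty_or_nonempty with hS' | hS'
  · refine htriv ?_
    rw [← Finset.add_sum_erase S _ hy, hS', Finset.sum_empty]
    nlinarith [hb y hy, hp y]
  obtain ⟨z, hz, hzmax⟩ := (S.erase y).exists_max_image p hS'
  have hyz : y ≠ z := (Finset.ne_of_mem_erase hz).symm
  have hzS : z ∈ S := Finset.mem_of_mem_erase hz
  -- The bound `b` absorbs `p y ^ 2`. The recursive call uses `p z` as its bound, and its loss `p z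
  -- ^ 2` together with the term of `z` itself makes up the `2 * p z ^ 2` that the new pair
  -- supplies.
  obtain ⟨k, u, v, h1, h2, h3, h4, h5⟩ := ih ((S.erase y).erase z)
    ((Finset.erase_ssubset hz).trans_subset (Finset.erase_subset _ _)) (p z)
    fun x hx => hzmax x (Finset.mem_of_mem_erase hx)
  have hmem : ∀ x ∈ (S.erase y).erase z, x ≠ y ∧ x ≠ z ∧ x ∈ S := fun x hx =>
    ⟨Finset.ne_of_mem_erase (Finset.mem_of_mem_erase hx), Finset.ne_of_mem_erase hx,
      Finset.mem_of_mem_erase (Finset.mem_of_mem_erase hx)⟩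
  have huv : ∀ i j, u i ≠ v j := fun i j h => by simpa using @h1 (.inl i) (.inr j) h
  refine ⟨k + 1, Fin.cons y u, Fin.cons z v, Function.Injective.sumElim ?_ ?_ ?_, ?_, ?_, ?_, ?_⟩
  · refine Fin.cons_injective_iff.2 ⟨?_, h1.comp Sum.inl_injective⟩
    rintro ⟨i, hi⟩
    exact (hmem _ (h2 i)).1 hi
  · refine Fin.cons_injective_iff.2 ⟨?_, h1.comp Sum.inr_injective⟩
    rintro ⟨i, hi⟩
    exact (hmem _ (h3 i)).2.1 hi
  · intro i j
    refine Fin.cases ?_ (fun i => ?_) i <;> refine Fin.cases ?_ (fun j => ?_) j <;>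
      simp only [Fin.cons_zero, Fin.cons_succ]
    exacts [hyz, (hmem _ (h3 j)).1.symm, (hmem _ (h2 i)).2.1, huv i j]
  · intro i
    refine Fin.cases ?_ (fun i => ?_) i
    exacts [hy, (hmem _ (h2 i)).2.2]
  · intro i
    refine Fin.cases ?_ (fun i => ?_) i
    exacts [hzS, (hmem _ (h3 i)).2.2]
  · intro i
    refine Fin.cases ?_ (fun i => ?_) i
    exacts [hymax z hzS, h4 i]
  · rw [Fin.sum_univ_succ, ← Finset.add_sum_erase S _ hy, ← Finset.add_sum_erase _ _ hz]
    simp only [Fin.cons_zero, Fin.cons_succ]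
    nlinarith [hb y hy, hp y]

/-! ### Symmetrization of an algorithm and extension to the fresh elements. -/

section Symmetrization

variable {n s : ℕ}

/-- The permutations of the positions that preserve the classes. -/
def classPerms (s : ℕ) : Subgroup (Equiv.Perm (Pos s)) where
  carrier := {σ | ∀ c, (σ c).1 = c.1}
  mul_mem' := fun {a b} ha hb c => (ha (b c)).trans (hb c)
  one_mem' := fun _ => rfl
  inv_mem' := fun {a} ha c => by
    have := ha (a⁻¹ c)
    rwa [show a (a⁻¹ c) = c from Equiv.apply_symm_apply a c, eq_comm] at this

open Classical in
/-- The mean of a statistic over relabellings of the domain and reorderings of the classes. -/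
def symmetrize (A : (Pos s → Fin n) → ℝ) (w : Pos s → Fin n) : ℝ :=
  (∑ π : Equiv.Perm (Fin n), ∑ σ : classPerms s, A (π ∘ w ∘ (σ : Equiv.Perm (Pos s)))) /
    (Fintype.card (Equiv.Perm (Fin n)) * Fintype.card (classPerms s))

theorem symmetrize_comp (A : (Pos s → Fin n) → ℝ) (π : Equiv.Perm (Fin n))
    (σ : Equiv.Perm (Pos s)) (hσ : ∀ c, (σ c).1 = c.1) (w : Pos s → Fin n) :
    symmetrize A (π ∘ w ∘ σ) = symmetrize A w := by
  classical
  unfold symmetrize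
  congr 1
  rw [← Equiv.sum_comp (Equiv.mulRight π)
    (fun ρ => ∑ τ : classPerms s, A (ρ ∘ w ∘ (τ : Equiv.Perm (Pos s))))]
  refine Finset.sum_congr rfl fun ρ _ => ?_
  exact Equiv.sum_comp (Equiv.mulLeft (⟨σ, hσ⟩ : classPerms s))
    (fun τ : classPerms s => A ((ρ * π : Equiv.Perm (Fin n)) ∘ w ∘ (τ : Equiv.Perm (Pos s))))

theorem symmetrize_mem {A : (Pos s → Fin n) → ℝ} (hA : ∀ w, 0 ≤ A w ∧ A w ≤ 1)
    (w : Pos s → Fin n) : 0 ≤ symmetrize A w ∧ symmetrize A w ≤ 1 := by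
  classical
  unfold symmetrize
  refine ⟨div_nonneg (Finset.sum_nonneg fun π _ => Finset.sum_nonneg fun σ _ => (hA _).1)
    (by positivity), ?_⟩
  refine div_le_one_of_le₀ ?_ (by positivity)
  refine (Finset.sum_le_sum fun π _ => Finset.sum_le_sum fun σ _ => (hA _).2).trans ?_
  simp

theorem expect_comp_perm {q : Fin 3 → Fin n → ℝ} (A : (Pos s → Fin n) → ℝ)
    (π : Equiv.Perm (Fin n)) (σ : Equiv.Perm (Pos s)) (hσ : ∀ c, (σ c).1 = c.1) :
    expect (fun c : Pos s => q c.1) (fun w => A (π ∘ w ∘ σ)) =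
      expect (fun c : Pos s => q c.1 ∘ π.symm) A := by
  unfold expect
  refine Fintype.sum_equiv (Equiv.arrowCongr σ.symm π) _ _ fun w => ?_
  have h1 : Equiv.arrowCongr σ.symm π w = π ∘ w ∘ σ := by
    funext c
    simp [Equiv.arrowCongr]
  rw [h1]
  congr 1
  rw [← Equiv.prod_comp σ]
  refine Finset.prod_congr rfl fun c _ => ?_
  simp [hσ]

/-- Reordering within classes preserves the law of the samples, so only the average over
relabellings remains, and a guarantee valid for all permuted pairs passes to the symmetrized
statistic. -/
theorem expect_symmetrize (q : Fin 3 → Fin n → ℝ) (A : (Pos s → Fin n) → ℝ) :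
    expect (fun c : Pos s => q c.1) (symmetrize A) =
      (∑ π : Equiv.Perm (Fin n), expect (fun c : Pos s => q c.1 ∘ π.symm) A) /
        Fintype.card (Equiv.Perm (Fin n)) := by
  classical
  have h2 : symmetrize A = fun w : Pos s → Fin n =>
    ((Fintype.card (Equiv.Perm (Fin n)) * Fintype.card (classPerms s) : ℝ))⁻¹ *
    ∑ π : Equiv.Perm (Fin n), ∑ σ : classPerms s, A (π ∘ w ∘ (σ : Equiv.Perm (Pos s))) := by
    funext w
    rw [symmetrize, div_eq_inv_mul]
  rw [h2, expect_const_mul, expect_sum]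
  simp only [expect_sum]
  rw [Finset.sum_congr rfl fun π _ => Finset.sum_congr rfl fun (σ : classPerms s) _ =>
    expect_comp_perm A π σ σ.2]
  have hc : (Fintype.card (classPerms s) : ℝ) ≠ 0 := Nat.cast_ne_zero.2 Fintype.card_ne_zero
  simp only [Finset.sum_const, Finset.card_univ, nsmul_eq_mul]
  rw [← Finset.mul_sum]
  field_simp

theorem le_expect_symmetrize {q : Fin 3 → Fin n → ℝ} {A : (Pos s → Fin n) → ℝ} {a : ℝ}
    (h : ∀ π : Equiv.Perm (Fin n), a ≤ expect (fun c : Pos s => q c.1 ∘ π.symm) A) :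
    a ≤ expect (fun c : Pos s => q c.1) (symmetrize A) := by
  rw [expect_symmetrize, le_div_iff₀ (by positivity)]
  exact le_trans (by simp [mul_comm]) (Finset.sum_le_sum fun π _ => h π)

theorem expect_symmetrize_le {q : Fin 3 → Fin n → ℝ} {A : (Pos s → Fin n) → ℝ} {a : ℝ}
    (h : ∀ π : Equiv.Perm (Fin n), expect (fun c : Pos s => q c.1 ∘ π.symm) A ≤ a) :
    expect (fun c : Pos s => q c.1) (symmetrize A) ≤ a := by
  rw [expect_symmetrize, div_le_iff₀ (by positivity)]
  exact le_trans (Finset.sum_le_sum fun π _ => h π) (by simp [mul_comm])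

/-- Both sequences have the same coincidences, and a bijection between their finite sets of values
extends to a permutation. This makes `extendStat` independent of the chosen representative. -/
theorem exists_perm_of_ext {v v' : Pos s → Fin n} {θ θ' : Equiv.Perm (Ext n s)}
    (h : θ ∘ Sum.inl ∘ v = θ' ∘ Sum.inl ∘ v') : ∃ π : Equiv.Perm (Fin n), v' = π ∘ v := by
  have hk : ∀ c c', v c = v c' ↔ v' c = v' c' := by
    intro c c'
    have h1 := congrFun h c
    have h2 := congrFun h c'
    simp only [Function.comp_apply] at h1 h2
    constructor
    · intro hv
      rw [hv, h2] at h1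
      exact (Sum.inl_injective (θ'.injective h1)).symm
    · intro hv
      rw [hv, ← h2] at h1
      exact Sum.inl_injective (θ.injective h1)
  classical
  let f : Fin n → Fin n := fun z => if hz : ∃ c, v c = z then v' hz.choose else z
  have hf : ∀ c, f (v c) = v' c := by
    intro c
    have hz : ∃ c', v c' = v c := ⟨c, rfl⟩
    simp only [f, dif_pos hz]
    exact (hk _ _).1 hz.choose_spec
  obtain ⟨g, hg⟩ := Finset.exists_equiv_extend_of_card_eq (t := (Finset.univ : Finset (Fin n)))
    (by simp) (s := Finset.univ.image v) (f := f) (Finset.subset_univ _) (by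
      intro x hx y hy hxy
      simp only [Finset.coe_image, Finset.coe_univ, Set.image_univ, Set.mem_range] at hx hy
      obtain ⟨c, rfl⟩ := hx
      obtain ⟨c', rfl⟩ := hy
      rw [hf, hf] at hxy
      exact (hk _ _).2 hxy)
  refine ⟨g.trans (Equiv.subtypeUnivEquiv fun x => Finset.mem_univ x), ?_⟩
  funext c
  simp only [Function.comp_apply, Equiv.trans_apply, Equiv.subtypeUnivEquiv_apply]
  rw [hg _ (Finset.mem_image_of_mem v (Finset.mem_univ c)), hf]

open Classical in
/-- The extension of a statistic to sequences over the extended domain. -/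
def extendStat (G : (Pos s → Fin n) → ℝ) (w : Pos s → Ext n s) : ℝ :=
  if h : ∃ (v : Pos s → Fin n) (θ : Equiv.Perm (Ext n s)), w = θ ∘ Sum.inl ∘ v then G h.choose
  else 0

theorem extendStat_apply {G : (Pos s → Fin n) → ℝ}
    (hG : ∀ (π : Equiv.Perm (Fin n)) w, G (π ∘ w) = G w) (v : Pos s → Fin n)
    (θ : Equiv.Perm (Ext n s)) : extendStat G (θ ∘ Sum.inl ∘ v) = G v := by
  have h : ∃ (v' : Pos s → Fin n) (θ' : Equiv.Perm (Ext n s)),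
    θ ∘ Sum.inl ∘ v = θ' ∘ Sum.inl ∘ v' := ⟨v, θ, rfl⟩
  rw [extendStat, dif_pos h]
  obtain ⟨θ', h'⟩ := h.choose_spec
  obtain ⟨π, hπ⟩ := exists_perm_of_ext h'
  rw [hπ, hG]

theorem extendStat_exchangeable {G : (Pos s → Fin n) → ℝ}
    (hG : ∀ (π : Equiv.Perm (Fin n)) (σ : Equiv.Perm (Pos s)), (∀ c, (σ c).1 = c.1) →
      ∀ w, G (π ∘ w ∘ σ) = G w) : Exchangeable (extendStat G) := by
  have hG' : ∀ (π : Equiv.Perm (Fin n)) w, G (π ∘ w) = G w := fun π w =>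
    hG π 1 (fun _ => rfl) w
  intro θ σ hσ w
  by_cases h : ∃ (v : Pos s → Fin n) (θ' : Equiv.Perm (Ext n s)), w = θ' ∘ Sum.inl ∘ v
  · obtain ⟨v, θ', rfl⟩ := h
    have e : θ ∘ (θ' ∘ Sum.inl ∘ v) ∘ σ = (θ * θ' : Equiv.Perm (Ext n s)) ∘ Sum.inl ∘ (v ∘ σ) := rfl
    rw [e, extendStat_apply hG', extendStat_apply hG']
    exact hG 1 σ hσ v
  -- Sequences with more than `n` distinct values have no representative and get the value 0; this
  -- set is invariant too.
  · have h' : ¬∃ (v : Pos s → Fin n) (θ' : Equiv.Perm (Ext n s)),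
        θ ∘ w ∘ σ = θ' ∘ Sum.inl ∘ v := by
      rintro ⟨v, θ', hv⟩
      refine h ⟨v ∘ σ.symm, θ⁻¹ * θ', ?_⟩
      funext c
      have := congrFun hv (σ.symm c)
      simp only [Function.comp_apply, Equiv.apply_symm_apply] at this
      simp only [Function.comp_apply, Equiv.Perm.mul_apply]
      rw [← this]
      exact (Equiv.symm_apply_apply θ (w c)).symm
    rw [extendStat, extendStat, dif_neg h, dif_neg h']

theorem extendStat_mem {G : (Pos s → Fin n) → ℝ} (hG : ∀ w, 0 ≤ G w ∧ G w ≤ 1)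
    (w : Pos s → Ext n s) : 0 ≤ extendStat G w ∧ extendStat G w ≤ 1 := by
  unfold extendStat
  split_ifs
  · exact hG _
  · norm_num

/-- The answer of an algorithm as a statistic of the whole sample sequence. -/
def Algorithm.stat (A : Algorithm n s) (w : Pos s → Fin n) : ℝ :=
  A (fun i => w (0, i)) (fun i => w (1, i)) (fun i => w (2, i))

theorem probFirst_eq_expect (A : Algorithm n s) (X Y T : Dist n) :
    probFirst A X Y T = expect (fun c : Pos s => ![X.1, Y.1, T.1] c.1) (Algorithm.stat A) := by
  let e : (Pos s → Fin n) ≃ Sample n s × Sample n s × Sample n s :=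
    { toFun := fun w => (fun i => w (0, i), fun i => w (1, i), fun i => w (2, i))
      invFun := fun t c => ![t.1, t.2.1, t.2.2] c.1 c.2
      left_inv := by
        intro w
        funext ⟨κ, i⟩
        fin_cases κ <;> rfl
      right_inv := fun t => rfl }
  unfold expect probFirst
  rw [← Equiv.sum_comp e.symm, Fintype.sum_prod_type]
  refine Finset.sum_congr rfl fun x _ => ?_
  rw [Fintype.sum_prod_type]
  refine Finset.sum_congr rfl fun y _ => Finset.sum_congr rfl fun t _ => ?_
  rw [Fintype.prod_prod_type, Fin.prod_univ_three]
  rfl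

theorem probSecond_eq (A : Algorithm n s) (X Y T : Dist n) :
    probSecond A X Y T = 1 - probFirst A X Y T := by
  have h : ∀ X : Dist n, ∑ x : Sample n s, sampleProb X x = 1 := by
    intro X
    have := expect_prod (fun _ : Fin s => X.1) (fun _ _ => 1)
    simp only [expect, Finset.prod_const_one, mul_one, X.2.2] at this
    exact this
  unfold probSecond probFirst
  simp only [mul_sub, mul_one, Finset.sum_sub_distrib, ← Finset.mul_sum, h]

end Symmetrization

/-! ### Numerical estimates for the number of hiding pairs. -/

/-- Index pairs in increasing order embed into `classPairs` for every class, including the testing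
class, where the order is imposed to count each pair once. -/
theorem card_classPairs (s : ℕ) (κ : Fin 3) :
    (s : ℝ) * (s - 1) / 2 ≤ (classPairs s κ).card := by
  have h1 : ((Finset.univ : Finset (Fin s × Fin s)).filter fun p => p.1 < p.2).card ≤
      (classPairs s κ).card := by
    refine Finset.card_le_card_of_injOn (fun p => ((κ, p.1), (2, p.2))) ?_ ?_
    · intro p hp
      simp only [Finset.coe_filter, Finset.mem_univ, true_and, Set.mem_ofPred_eq] at hp
      simp [classPairs, hp]
    · intro p _ p' _ h
      simp only [Prod.mk.injEq, true_and] at h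
      exact Prod.ext h.1 h.2
  have h2 : ((Finset.univ : Finset (Fin s × Fin s)).filter fun p => p.1 < p.2).card =
      ∑ i ∈ Finset.range s, i := by
    rw [Finset.card_filter, Fintype.sum_prod_type, Finset.sum_comm,
      ← Fin.sum_univ_eq_sum_range (fun i => i) s]
    refine Finset.sum_congr rfl fun j _ => ?_
    dsimp only
    rw [← Finset.card_filter, ← Fin.card_Iio j]
    congr 1
    ext i
    simp
  have h3 := Finset.sum_range_id_mul_two s
  rw [h2] at h1
  have h4 : ((∑ i ∈ Finset.range s, i : ℕ) : ℝ) * 2 = s * (s - 1) := by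
    rcases s with _ | s
    · simp
    · rw [Nat.add_sub_cancel] at h3
      have : (((∑ i ∈ Finset.range (s + 1), i : ℕ) * 2 : ℕ) : ℝ) = ((s + 1) * s : ℕ) := by rw [h3]
      push_cast at this ⊢
      rw [this]
      ring
  have h5 : ((∑ i ∈ Finset.range s, i : ℕ) : ℝ) ≤ (classPairs s κ).card := by exact_mod_cast h1
  linarith

/-- Since 1 - 2/s is the inverse of 1 + 2/(s - 2), it is at least exp(-2/(s - 2)); the power `3 * s`
is then at least exp(-12) ≥ 3⁻¹² = 1/531441. -/
theorem le_pow_of_one_sub_le {s : ℕ} (hs : 4 ≤ s) {ρ : ℝ} (h : 1 - 2 / (s : ℝ) ≤ ρ) :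
    (1 / 531441 : ℝ) ≤ ρ ^ (3 * s) := by
  have hs' : (4 : ℝ) ≤ s := by exact_mod_cast hs
  have h1 : Real.exp (-(2 / (s - 2 : ℝ))) ≤ ρ := by
    rw [Real.exp_neg]
    have h2 := Real.add_one_le_exp (2 / (s - 2 : ℝ))
    have h3 : 2 / (s - 2 : ℝ) + 1 = s / (s - 2) := by
      have : (s - 2 : ℝ) ≠ 0 := by linarith
      field_simp
      ring
    rw [h3] at h2
    have h4 : (0 : ℝ) < s / (s - 2) := div_pos (by linarith) (by linarith)
    refine (inv_anti₀ h4 h2).trans (le_trans (le_of_eq ?_) h)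
    have : (s : ℝ) ≠ 0 := by linarith
    rw [inv_div]
    field_simp
  have h2 : Real.exp (-12) ≤ ρ ^ (3 * s) := by
    refine le_trans ?_ (pow_le_pow_left₀ (Real.exp_pos _).le h1 _)
    rw [← Real.exp_nat_mul]
    refine Real.exp_le_exp.2 ?_
    push_cast
    have h5 : (s : ℝ) * (2 / (s - 2)) ≤ 4 := by
      rw [mul_div_assoc', div_le_iff₀ (by linarith)]
      linarith
    linarith
  refine le_trans ?_ h2
  have h3 : Real.exp (-12) = ((Real.exp 1) ^ 12)⁻¹ := by
    rw [Real.exp_neg, ← Real.exp_nat_mul]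
    norm_num
  rw [h3, one_div]
  refine inv_anti₀ (by positivity) ?_
  refine (pow_le_pow_left₀ (Real.exp_pos 1).le (by linarith [Real.exp_one_lt_d9] : Real.exp 1 ≤ 3)
    12).trans ?_
  norm_num

/-! ### Hiding the collisions in `D`. -/

section Hiding

variable {n s k : ℕ} {u v : Fin k → Fin n} {D : Finset (Fin n)} {W : Fin 3 → Fin n → ℝ}

theorem labelMass_congr {w w' : Fin n → ℝ} (h : ∀ z ∉ D, w z = w' z) (hv : ∀ i, v i ∉ D)
    {x : Lab n k} (hx : x ∉ D.image Sum.inr) : labelMass u v w x = labelMass u v w' x := by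
  rcases x with i | z
  · simp only [labelMass, h _ (hv i)]
  · have hz : z ∉ D := fun hz => hx (Finset.mem_image_of_mem _ hz)
    simp only [labelMass, h _ hz, h _ (hv _)]

/-- Once the testing samples in `D` are replaced by fresh elements, the law of the sample sequence
only depends on the common part of the distributions. -/
theorem expect_forget_eq {W' : Fin 3 → Fin n → ℝ} (h0 : W 0 = W' 0) (h1 : W 1 = W' 1)
    (h2 : ∀ z ∉ D, W 2 z = W' 2 z) (hs : ∑ z, W 2 z = ∑ z, W' 2 z) (hv : ∀ i, v i ∉ D)
    (F : (Pos s → Ext n s) → ℝ) :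
    expect (fun (c : Pos s) x => labelMass u v (W c.1) x)
        (fun l => coinMean fun β => F (hybrid u v D 0 l β)) =
      expect (fun (c : Pos s) x => labelMass u v (W' c.1) x)
        (fun l => coinMean fun β => F (hybrid u v D 0 l β)) := by
  have e1 := expect_coins (fun (c : Pos s) (x : Lab n k) => labelMass u v (W c.1) x)
    (fun y => F fun c => hybridLetter u v D 0 c (y c).1 (y c).2)
  have e2 := expect_coins (fun (c : Pos s) (x : Lab n k) => labelMass u v (W' c.1) x)
    (fun y => F fun c => hybridLetter u v D 0 c (y c).1 (y c).2)
  refine e1.symm.trans (Eq.trans ?_ e2)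
  have hmap := fun (m : Pos s → Lab n k × Bool → ℝ) q hq =>
    expect_map m q (fun c x => hybridLetter u v D 0 c x.1 x.2) hq F
  rw [← hmap _ (fun c w => ∑ x : Lab n k × Bool, if hybridLetter u v D 0 c x.1 x.2 = w then
    labelMass u v (W c.1) x.1 / 2 else 0) (fun c w => rfl), ← hmap _ _ fun c w => ?_]
  rcases c with ⟨κ, j⟩
  have hκ : κ = 2 ∨ W κ = W' κ := by
    fin_cases κ
    exacts [Or.inr h0, Or.inr h1, Or.inl rfl]
  rcases hκ with rfl | hκ
  swap
  · simp only [hκ]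
  rcases w with z | i
  · refine Finset.sum_congr rfl fun x _ => ?_
    by_cases hx : x.1 ∈ D.image Sum.inr
    · simp [hybridLetter, -Finset.mem_image, hx]
    · simp only [labelMass_congr h2 hv hx]
  · by_cases hij : j = i
    · subst hij
      -- The fresh letter receives the total mass minus the mass of the labels outside `D`, and both
      -- are common to the two laws.
      have h3 : ∀ w : Fin n → ℝ, (∑ x : Lab n k × Bool,
          if hybridLetter u v D 0 ((2, j) : Pos s) x.1 x.2 = Sum.inr j then
            labelMass u v w x.1 / 2 else 0) =
          ∑ z, w z - ∑ x : Lab n k × Bool,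
            if x.1 ∈ D.image Sum.inr then 0 else labelMass u v w x.1 / 2 := by
        intro w
        have h4 : ∑ z, w z = ∑ x : Lab n k × Bool, labelMass u v w x.1 / 2 := by
          rw [← sum_labelMass (u := u) (v := v), Fintype.sum_prod_type]
          refine Finset.sum_congr rfl fun x _ => ?_
          rw [Fintype.sum_bool]
          ring
        rw [h4, ← Finset.sum_sub_distrib]
        refine Finset.sum_congr rfl fun x _ => ?_
        by_cases hx : x.1 ∈ D.image Sum.inr
        · simp [hybridLetter, -Finset.mem_image, hx]
        · simp [hybridLetter, -Finset.mem_image, hx]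
      dsimp only
      rw [h3, h3, hs]
      congr 1
      refine Finset.sum_congr rfl fun x _ => ?_
      split_ifs with hx
      · rfl
      · rw [labelMass_congr h2 hv hx]
    · have h3 : ∀ x : Lab n k × Bool,
          hybridLetter u v D 0 ((2, j) : Pos s) x.1 x.2 ≠ Sum.inr i := by
        intro x h
        simp only [hybridLetter] at h
        split_ifs at h
        exact hij (Sum.inr.inj h)
      simp only [h3, if_false]

/-- The law of the samples in terms of labels and coins. -/
theorem expect_real_eq (F : (Pos s → Ext n s) → ℝ) :
    expect (fun c : Pos s => W c.1) (fun w => F (Sum.inl ∘ w)) =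
      expect (fun (c : Pos s) x => labelMass u v (W c.1) x)
        (fun l => coinMean fun β => F (hybrid u v D s l β)) := by
  have e1 := expect_coins (fun (c : Pos s) (x : Lab n k) => labelMass u v (W c.1) x)
    (fun y => F fun c => hybridLetter u v D s c (y c).1 (y c).2)
  refine Eq.trans ?_ e1
  rw [expect_map (fun (c : Pos s) (x : Lab n k × Bool) => labelMass u v (W c.1) x.1 / 2) _
    (fun _ x => letter u v x.1 x.2) (fun c z => map_labelMass z)]
  congr 1
  funext y
  congr 1
  funext c
  simp only [Function.comp_apply, hybridLetter]
  rw [if_neg]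
  rintro ⟨-, h, -⟩
  exact absurd c.2.2 (by omega)

open Classical in
/-- The number of pairs that can hide a collision of a testing sample is large. -/
theorem expect_few_hitPairs_le (hW0 : ∀ κ z, 0 ≤ W κ z) (hW1 : ∀ κ, ∑ z, W κ z = 1)
    (hcommon : ∀ z ∉ D, ∀ κ, W κ z = W 0 z) (hmax : ∀ z, (s : ℝ) * W 0 z ≤ 1)
    (huv : Function.Injective (Sum.elim u v)) (hu : ∀ i, u i ∉ D) (hv : ∀ i, v i ∉ D)
    (hle : ∀ i, W 0 (v i) ≤ W 0 (u i)) {Y : ℝ} (hY : Y = s ^ 2 * ∑ i, W 0 (v i) ^ 2)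
    (hYbig : 2 * 10 ^ 8 ≤ Y) (κ : Fin 3) :
    expect (fun (c : Pos s) x => labelMass u v (W c.1) x) (fun l =>
      if ((hitPairs u v κ l).card : ℝ) < Y / 1062882 then 1 else 0) ≤ 1 / 48 := by
  have hs0 : (0 : ℝ) ≤ s := Nat.cast_nonneg s
  -- Since `s * W 0 z ≤ 1`, a large `Y` forces a large `s`; this brings `ρ` close to 1 and hence `K`
  -- close to 1.
  have hYs : Y ≤ s := by
    have h1 : ∀ i, (s : ℝ) ^ 2 * W 0 (v i) ^ 2 ≤ s * W 0 (v i) := by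
      intro i
      have := hmax (v i)
      have h2 : 0 ≤ (s : ℝ) * W 0 (v i) := mul_nonneg hs0 (hW0 _ _)
      nlinarith
    have h2 : ∑ i, W 0 (v i) ≤ 1 := by
      rw [← hW1 0]
      have hinj : Function.Injective v := huv.comp Sum.inr_injective
      rw [← Finset.sum_image (f := W 0) (g := v) (s := Finset.univ) (fun a _ b _ h => hinj h)]
      exact Finset.sum_le_sum_of_subset_of_nonneg (Finset.subset_univ _) fun z _ _ => hW0 0 z
    rw [hY, Finset.mul_sum]
    refine (Finset.sum_le_sum fun i _ => h1 i).trans ?_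
    rw [← Finset.mul_sum]
    nlinarith
  have hs : (2 * 10 ^ 8 : ℝ) ≤ s := hYbig.trans hYs
  have hspos : (0 : ℝ) < s := by linarith
  have hp : ∀ z, W 0 z ≤ 1 / s := fun z => by
    rw [le_div_iff₀ hspos, mul_comm]
    exact hmax z
  have hsmall : 2 / (s : ℝ) ≤ 1 / 10 ^ 8 := by
    rw [div_le_div_iff₀ hspos (by norm_num)]
    linarith
  have hρ : ∀ i, 1 - 2 / (s : ℝ) ≤ 1 - (W 0 (u i) + W 0 (v i)) := by
    intro i
    have : 2 / (s : ℝ) = 1 / s + 1 / s := by ring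
    linarith [hp (u i), hp (v i)]
  have hρ1 : ∀ i, 1 - (W 0 (u i) + W 0 (v i)) ≤ 1 := fun i => by
    linarith [hW0 0 (u i), hW0 0 (v i)]
  have hρ0 : ∀ i, 0 < 1 - (W 0 (u i) + W 0 (v i)) := fun i => by linarith [hρ i]
  set μ : ℝ := ∑ i, ((classPairs s κ).card : ℝ) * ((2 * W 0 (v i) /
    (1 - (W 0 (u i) + W 0 (v i)))) ^ 2 *
      (1 - (W 0 (u i) + W 0 (v i))) ^ Fintype.card (Pos s)) with hμ
  -- There are at least s²/4 position pairs, and the label mass `2 * W 0 (v i)` squared cancels the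
  -- 4; only the factor 3⁻¹² for avoidance by the other samples is lost.
  have hμY : Y / 531441 ≤ μ := by
    rw [hμ, hY, Finset.mul_sum, Finset.sum_div]
    refine Finset.sum_le_sum fun i _ => ?_
    have h1 : (s : ℝ) ^ 2 / 4 ≤ (classPairs s κ).card := by
      refine le_trans ?_ (card_classPairs s κ)
      nlinarith
    have h2 : (2 * W 0 (v i)) ^ 2 ≤ (2 * W 0 (v i) / (1 - (W 0 (u i) + W 0 (v i)))) ^ 2 := by
      have h3 : 0 ≤ 2 * W 0 (v i) := by linarith [hW0 0 (v i)]
      refine pow_le_pow_left₀ h3 ?_ 2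
      rw [le_div_iff₀ (hρ0 i)]
      nlinarith [hρ1 i]
    have h3 : (1 / 531441 : ℝ) ≤ (1 - (W 0 (u i) + W 0 (v i))) ^ Fintype.card (Pos s) := by
      rw [Fintype.card_prod, Fintype.card_fin, Fintype.card_fin]
      refine le_pow_of_one_sub_le ?_ (hρ i)
      have : (4 : ℝ) ≤ s := by linarith
      exact_mod_cast this
    calc (s : ℝ) ^ 2 * W 0 (v i) ^ 2 / 531441
        = (s : ℝ) ^ 2 / 4 * ((2 * W 0 (v i)) ^ 2 * (1 / 531441)) := by ring
      _ ≤ _ := mul_le_mul h1 (mul_le_mul h2 h3 (by norm_num) (sq_nonneg _)) (by positivity)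
          (Nat.cast_nonneg _)
  have hμ0 : 0 < μ := by linarith
  have hm : ∀ (c : Pos s) x, 0 ≤ labelMass u v (W c.1) x := fun c =>
    labelMass_nonneg huv (hW0 c.1) fun i => by
      rw [hcommon _ (hu i), hcommon _ (hv i)]
      exact hle i
  have hm1 : ∀ c : Pos s, ∑ x, labelMass u v (W c.1) x = 1 := fun c => by
    rw [sum_labelMass, hW1]
  have hK : ∀ i, 1 ≤ (1 + 1 / 10 ^ 7 : ℝ) * (1 - (W 0 (u i) + W 0 (v i))) := by
    intro i
    linarith [hρ i, hρ1 i]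
  have key := expect_soleHit_lower_tail (m := fun (c : Pos s) x => labelMass u v (W c.1) x)
    hm hm1 (blk := block u v)
    (fun i j hij => block_disjoint huv hij) (x := Sum.inl) (fun i => by simp [block])
    (r := fun i => 2 * W 0 (v i)) (ρ := fun i => 1 - (W 0 (u i) + W 0 (v i)))
    (K := 1 + 1 / 10 ^ 7)
    (fun i c => by simp only [labelMass, hcommon _ (hv i)])
    (fun i c => by rw [sum_compl_block huv, hW1, hcommon _ (hu i), hcommon _ (hv i)])
    hρ0 hK (A := classPairs s κ) classPairs_ne classPairs_swap hμ0 hμ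
  -- The target 1/48 lets the three classes together cost 1/16.
  have hfin : 4 / μ + 4 * ((1 + 1 / 10 ^ 7 : ℝ) ^ 4 - 1) ≤ 1 / 48 := by
    have h1 : 4 / μ ≤ 1 / 90 := by
      rw [div_le_div_iff₀ hμ0 (by norm_num)]
      linarith
    have h2 : 4 * ((1 + 1 / 10 ^ 7 : ℝ) ^ 4 - 1) ≤ 1 / 48 - 1 / 90 := by norm_num
    linarith
  refine le_trans (expect_mono hm fun l => ?_) (key.trans hfin)
  have hcard : (Finset.univ.filter fun i : Fin k => ∃ p ∈ classPairs s κ,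
      soleHit (block u v i) (Sum.inl i) p.1 p.2 l = 1) = hitPairs u v κ l := by
    unfold hitPairs
    congr
  rw [hcard]
  split_ifs with h1 h2
  exacts [le_rfl, absurd (by linarith) h2, zero_le_one, le_rfl]

open Classical in
/-- The collisions of the testing samples in `D` are hidden. -/
theorem abs_expect_sub_forget_le (hW0 : ∀ κ z, 0 ≤ W κ z) (hW1 : ∀ κ, ∑ z, W κ z = 1)
    (hcommon : ∀ z ∉ D, ∀ κ, W κ z = W 0 z) (hmax : ∀ z, (s : ℝ) * W 0 z ≤ 1)
    (hD : ∀ z ∈ D, W 2 z = 0 ∨ W 0 z + W 1 z = W 2 z)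
    (huv : Function.Injective (Sum.elim u v)) (hu : ∀ i, u i ∉ D) (hv : ∀ i, v i ∉ D)
    (hle : ∀ i, W 0 (v i) ≤ W 0 (u i)) {Y σ : ℝ} (hY : Y = s ^ 2 * ∑ i, W 0 (v i) ^ 2)
    (hcube : (s : ℝ) ^ 3 * ∑ z ∈ D, W 2 z ^ 3 ≤ 1 / 64)
    (hσ : (s : ℝ) ^ 2 * ∑ z ∈ D, W 2 z ^ 2 ≤ σ)
    (hcase : σ ≤ 1 / 16 ∨ 10 ^ 11 * σ ^ 2 ≤ Y ∧ 2 * 10 ^ 8 ≤ Y)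
    {F : (Pos s → Ext n s) → ℝ} (hF : Exchangeable F) (hF01 : ∀ w, 0 ≤ F w ∧ F w ≤ 1) :
    |expect (fun c : Pos s => W c.1) (fun w => F (Sum.inl ∘ w)) -
      expect (fun (c : Pos s) x => labelMass u v (W c.1) x)
        (fun l => coinMean fun β => F (hybrid u v D 0 l β))| ≤ 5 / 16 := by
  rw [expect_real_eq (u := u) (v := v) (D := D)]
  have hm : ∀ (c : Pos s) x, 0 ≤ labelMass u v (W c.1) x := fun c =>
    labelMass_nonneg huv (hW0 c.1) fun i => by
      rw [hcommon _ (hu i), hcommon _ (hv i)]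
      exact hle i
  have hm1 : ∀ c : Pos s, ∑ x, labelMass u v (W c.1) x = 1 := fun c => by
    rw [sum_labelMass, hW1]
  have hmD : ∀ c : Pos s, ∀ d ∈ D, labelMass u v (W c.1) (.inr d) = W c.1 d := fun c d hd =>
    labelMass_inr_of_ne (fun i h => hu i (h ▸ hd)) (fun i h => hv i (h ▸ hd))
  have htriple := expect_tripleIn_le hm hm1 hmD
  have hcoll := expect_collisions_le hm hm1 hmD
  -- Where the testing law charges `D`, the two training masses add up to the testing mass, so the
  -- three masses sum to `2 * W 2 d`.
  have e3 : ∑ d ∈ D, W 2 d * (W 0 d + W 1 d + W 2 d) ^ 2 = 4 * ∑ z ∈ D, W 2 z ^ 3 := by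
    rw [Finset.mul_sum]
    refine Finset.sum_congr rfl fun d hd => ?_
    rcases hD d hd with h | h
    · simp [h]
    · rw [h]
      ring
  have e2 : ∑ d ∈ D, W 2 d * (W 0 d + W 1 d + W 2 d) = 2 * ∑ z ∈ D, W 2 z ^ 2 := by
    rw [Finset.mul_sum]
    refine Finset.sum_congr rfl fun d hd => ?_
    rcases hD d hd with h | h
    · simp [h]
    · rw [h]
      ring
  rw [e3] at htriple
  rw [e2] at hcoll
  rcases hcase with hcase | ⟨hcase, hYbig⟩
  -- With few collisions the choice `η = 1` suffices, and no hiding pairs are required.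
  · have := abs_expect_hybrid_le hF hF01 huv hu hv hm zero_le_one (fun _ => False)
      (fun l _ => Or.inl le_rfl)
    simp only [if_false, expect_const hm1] at this
    linarith
  · have hYpos : 0 < Y := by linarith
    -- Half the mean number of hitting pairs is at least `Y / 1062882`, where 1062882 = 2·3¹²; the
    -- smoothing bound needs `η ^ 2` to be 4 divided by this, and 4251528 = 4·1062882.
    have hη : (Real.sqrt (4251528 / Y)) ^ 2 = 4251528 / Y := Real.sq_sqrt (by positivity)
    obtain ⟨B, hB⟩ : ∃ B : (Pos s → Lab n k) → Prop, ∀ l, B l ↔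
        ∃ κ, ((hitPairs u v κ l).card : ℝ) < Y / 1062882 := ⟨_, fun _ => Iff.rfl⟩
    have := abs_expect_hybrid_le hF hF01 huv hu hv hm (Real.sqrt_nonneg (4251528 / Y)) B
      (fun l hl => by
        right
        rw [hB] at hl
        push Not at hl
        intro κ
        rw [hη]
        calc (4 : ℝ) = 4251528 / Y * (Y / 1062882) := by field_simp; norm_num
          _ ≤ _ := mul_le_mul_of_nonneg_left (hl κ) (by positivity))
    have hbad : expect (fun (c : Pos s) x => labelMass u v (W c.1) x) (fun l =>
        if B l then 1 else 0) ≤ 1 / 16 := by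
      have h1 : ∀ l : Pos s → Lab n k, (if B l then (1 : ℝ) else 0) ≤
          ∑ κ : Fin 3, if ((hitPairs u v κ l).card : ℝ) < Y / 1062882 then 1 else 0 := by
        intro l
        have h0 : ∀ κ : Fin 3, (0 : ℝ) ≤
            if ((hitPairs u v κ l).card : ℝ) < Y / 1062882 then 1 else 0 := fun κ => by
          split_ifs <;> norm_num
        split_ifs with h
        · obtain ⟨κ, hκ⟩ := (hB l).1 h
          refine le_trans ?_ (Finset.single_le_sum (fun κ _ => h0 κ) (Finset.mem_univ κ))
          rw [if_pos hκ]
        · exact Finset.sum_nonneg fun κ _ => h0 κ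
      refine (expect_mono hm h1).trans ?_
      rw [expect_sum]
      refine (Finset.sum_le_sum fun κ _ => expect_few_hitPairs_le hW0 hW1 hcommon hmax huv hu hv
        hle hY hYbig κ).trans ?_
      norm_num
    have hσ0 : 0 ≤ σ := le_trans (mul_nonneg (by positivity)
      (Finset.sum_nonneg fun z _ => sq_nonneg _)) hσ
    have hlast : Real.sqrt (4251528 / Y) * (2 * σ) ≤ 1 / 8 := by
      refine abs_le_of_sq_le_sq' ?_ (by norm_num) |>.2
      rw [mul_pow, hη, div_mul_eq_mul_div, div_le_iff₀ hYpos]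
      nlinarith
    have h2 : Real.sqrt (4251528 / Y) * expect (fun (c : Pos s) x => labelMass u v (W c.1) x)
        (collisions D) ≤ 1 / 8 :=
      (mul_le_mul_of_nonneg_left (by linarith) (Real.sqrt_nonneg _)).trans hlast
    refine this.trans ((add_le_add (add_le_add htriple hbad) h2).trans ?_)
    linarith

end Hiding

/-! ### The norm conditions and the conclusion. -/

section Norms

variable {n : ℕ}

theorem lpNorm_two_sq (w : Fin n → ℝ) : lpNorm 2 w ^ 2 = ∑ z, w z ^ 2 := by
  unfold lpNorm
  rw [PiLp.norm_sq_eq_of_L2]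
  simp

theorem lpNorm_three_pow (w : Fin n → ℝ) : lpNorm 3 w ^ 3 = ∑ z, |w z| ^ 3 := by
  unfold lpNorm
  rw [PiLp.norm_eq_sum (by norm_num)]
  have h3 : (3 : ℝ≥0∞).toReal = (3 : ℕ) := by norm_num
  simp only [h3, Real.rpow_natCast, Real.norm_eq_abs]
  rw [one_div]
  exact Real.rpow_inv_natCast_pow (Finset.sum_nonneg fun z _ => by positivity) (by norm_num)

theorem le_lpNorm_top (w : Fin n → ℝ) (z : Fin n) : w z ≤ lpNorm ∞ w := by
  have := PiLp.norm_apply_le (WithLp.toLp ∞ w : PiLp ∞ fun _ : Fin n => ℝ) z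
  exact (le_abs_self _).trans this

theorem lpNorm_nonneg (p : ℝ≥0∞) [Fact (1 ≤ p)] (w : Fin n → ℝ) : 0 ≤ lpNorm p w := norm_nonneg _

theorem lpNorm_pos {p : ℝ≥0∞} [Fact (1 ≤ p)] {w : Fin n → ℝ} (hw : w ≠ 0) : 0 < lpNorm p w := by
  refine norm_pos_iff.2 fun h => hw ?_
  exact (WithLp.toLp_eq_zero p).1 h

end Norms

theorem Dist.val_ne_zero {n : ℕ} (P : Dist n) : P.1 ≠ 0 := by
  intro h
  have := P.2.2
  simp [h] at this

/-- What the bound on the number of samples says about the distributions. -/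
theorem sampleBound_spec {n s : ℕ} {P Q : Dist n} (hPQ : P ≠ Q) {c : ℝ} (hc : 0 < c)
    (h : (s : ℝ) ≤ sampleBound c P Q) :
    (s : ℝ) ^ 3 * ∑ z, |P.1 z - Q.1 z| ^ 3 ≤ 1 / 64 ∧ (∀ z, (s : ℝ) * P.1 z ≤ 1) ∧
      (∀ z, (s : ℝ) * Q.1 z ≤ 1) ∧
      c ^ 2 * ((s : ℝ) * ∑ z, (P.1 z - Q.1 z) ^ 2) ^ 2 ≤ ∑ z, (P.1 z + Q.1 z) ^ 2 := by
  have hne : P.1 - Q.1 ≠ 0 := fun h => hPQ (Subtype.ext (sub_eq_zero.1 h))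
  have : Fact ((1 : ℝ≥0∞) ≤ 3) := ⟨by norm_num⟩
  unfold sampleBound at h
  obtain ⟨⟨h1, h2⟩, h3, h4⟩ := And.imp le_min_iff.1 le_min_iff.1 (le_min_iff.1 h)
  have hs : (0 : ℝ) ≤ s := Nat.cast_nonneg s
  refine ⟨?_, fun z => ?_, fun z => ?_, ?_⟩
  · rw [le_div_iff₀ (lpNorm_pos hne)] at h1
    have := pow_le_pow_left₀ (mul_nonneg hs (lpNorm_nonneg _ _)) h1 3
    rw [mul_pow, lpNorm_three_pow] at this
    refine this.trans ?_
    norm_num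
  · rw [le_div_iff₀ (lpNorm_pos P.val_ne_zero)] at h2
    exact (mul_le_mul_of_nonneg_left (le_lpNorm_top _ z) hs).trans h2
  · rw [le_div_iff₀ (lpNorm_pos Q.val_ne_zero)] at h3
    exact (mul_le_mul_of_nonneg_left (le_lpNorm_top _ z) hs).trans h3
  · have hpos : 0 < lpNorm 2 (P.1 - Q.1) ^ 2 := pow_pos (lpNorm_pos hne) 2
    rw [← mul_div_assoc, le_div_iff₀ hpos, one_div, inv_mul_eq_div, le_div_iff₀ hc] at h4
    have := pow_le_pow_left₀ (mul_nonneg (mul_nonneg hs hpos.le) hc.le) h4 2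
    rw [lpNorm_two_sq, lpNorm_two_sq] at this
    simp only [Pi.sub_apply, Pi.add_apply] at this
    linarith [this]

/-- No algorithm reaches the error `1 / 8`. -/
theorem not_solves_eighth {n s : ℕ} {P Q : Dist n} (hPQ : P ≠ Q) (hwd : WeaklyDisjoint P Q)
    (h : (s : ℝ) ≤ sampleBound (10 ^ 7) P Q) (A : Algorithm n s) :
    ¬Solves A (1 / 8) (permutedPairs P Q) := by
  intro hA
  obtain ⟨h3, hP, hQ, h2⟩ := sampleBound_spec hPQ (by norm_num) h
  set D : Finset (Fin n) := Finset.univ.filter fun z => P.1 z ≠ Q.1 z with hDdef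
  have hD : ∀ z, z ∉ D ↔ P.1 z = Q.1 z := fun z => by simp [hDdef]
  have hsingle : ∀ z ∈ D, (0 < P.1 z ∧ Q.1 z = 0) ∨ (0 < Q.1 z ∧ P.1 z = 0) := by
    intro z hz
    have hne : P.1 z ≠ Q.1 z := by simpa [hDdef] using hz
    rcases hwd z with h | h
    · exact absurd h hne
    · exact h
  have hs0 : (0 : ℝ) ≤ s := Nat.cast_nonneg s
  -- The value `1 / s` serves as `b` unless `s = 0`, where it would be 0 and the trivial bound 1 is
  -- taken.
  obtain ⟨b, hb, hsb⟩ : ∃ b : ℝ, (∀ z, P.1 z ≤ b) ∧ (s : ℝ) ^ 2 * b ^ 2 ≤ 1 := by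
    rcases hs0.eq_or_lt with h0 | h0
    · refine ⟨1, fun z => ?_, by rw [← h0]; norm_num⟩
      rw [← P.2.2]
      exact Finset.single_le_sum (fun z _ => P.2.1 z) (Finset.mem_univ z)
    · refine ⟨1 / s, fun z => ?_, le_of_eq (by field_simp)⟩
      rw [le_div_iff₀ h0, mul_comm]
      exact hP z
  obtain ⟨k, u, v, huv, hu, hv, hle, hpair⟩ := exists_pairing P.1 P.2.1 Dᶜ b fun z _ => hb z
  have hu' : ∀ i, u i ∉ D := fun i => Finset.mem_compl.1 (hu i)
  have hv' : ∀ i, v i ∉ D := fun i => Finset.mem_compl.1 (hv i)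
  set σ : ℝ := (s : ℝ) ^ 2 * ∑ z, (P.1 z - Q.1 z) ^ 2 with hσ
  set Y : ℝ := (s : ℝ) ^ 2 * ∑ i, P.1 (v i) ^ 2 with hY
  -- By weak disjointness the squared norm of `P + Q` is that of `P - Q` plus four times the common
  -- part, and pairing loses at most 1 from s² times the latter. Hence 10¹⁴σ² ≤ σ + 8Y + 4, and for
  -- σ > 1/16 the left side dominates.
  have hcase : σ ≤ 1 / 16 ∨ 10 ^ 11 * σ ^ 2 ≤ Y ∧ 2 * 10 ^ 8 ≤ Y := by
    refine or_iff_not_imp_left.2 fun hσ16 => ?_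
    push Not at hσ16
    have hsplit : ∑ z, (P.1 z + Q.1 z) ^ 2 =
        ∑ z, (P.1 z - Q.1 z) ^ 2 + 4 * ∑ z ∈ Dᶜ, P.1 z ^ 2 := by
      rw [← Finset.sum_add_sum_compl D, ← Finset.sum_add_sum_compl D (fun z => (P.1 z - Q.1 z) ^ 2),
        add_assoc, Finset.mul_sum, ← Finset.sum_add_distrib]
      congr 1
      · refine Finset.sum_congr rfl fun z hz => ?_
        rcases hsingle z hz with ⟨-, h⟩ | ⟨-, h⟩ <;> rw [h] <;> ring
      · refine Finset.sum_congr rfl fun z hz => ?_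
        rw [(hD z).1 (Finset.mem_compl.1 hz)]
        ring
    have h5 : (10 ^ 7) ^ 2 * σ ^ 2 ≤ σ + 4 * ((s : ℝ) ^ 2 * ∑ z ∈ Dᶜ, P.1 z ^ 2) := by
      rw [hsplit] at h2
      have := mul_le_mul_of_nonneg_left h2 (sq_nonneg (s : ℝ))
      calc (10 ^ 7) ^ 2 * σ ^ 2 = (s : ℝ) ^ 2 * ((10 ^ 7) ^ 2 *
            ((s : ℝ) * ∑ z, (P.1 z - Q.1 z) ^ 2) ^ 2) := by rw [hσ]; ring
        _ ≤ _ := this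
        _ = _ := by rw [hσ]; ring
    have h6 : (s : ℝ) ^ 2 * ∑ z ∈ Dᶜ, P.1 z ^ 2 - 1 ≤ 2 * Y := by
      have := mul_le_mul_of_nonneg_left hpair (sq_nonneg (s : ℝ))
      rw [mul_sub] at this
      rw [hY]
      linarith
    constructor <;> nlinarith
  have hA' : ∀ w, 0 ≤ A.stat w ∧ A.stat w ≤ 1 := fun w => (A _ _ _).2
  set G := symmetrize A.stat with hG
  have hGinv : ∀ (π : Equiv.Perm (Fin n)) (τ : Equiv.Perm (Pos s)), (∀ c, (τ c).1 = c.1) →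
      ∀ w, G (π ∘ w ∘ τ) = G w := symmetrize_comp A.stat
  have hF := extendStat_exchangeable hGinv
  have hF01 := extendStat_mem (symmetrize_mem hA')
  have hFG : ∀ w : Pos s → Fin n, extendStat G (Sum.inl ∘ w) = G w := fun w =>
    extendStat_apply (fun π w => hGinv π 1 (fun _ => rfl) w) w 1
  have hne : ∀ π, permute π P ≠ permute π Q := by
    intro π hπ
    refine hPQ (Subtype.ext (funext fun z => ?_))
    have := congrFun (congrArg Subtype.val hπ) (π z)
    simpa [permute] using this
  have hsolve := fun π => (hA (permute π P) (permute π Q) ⟨π, rfl⟩).1 (hne π)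
  have hlaw : ∀ (π : Equiv.Perm (Fin n)) (T : Dist n),
      (fun c : Pos s => ![(permute π P).1, (permute π Q).1, (permute π T).1] c.1) =
        fun c : Pos s => ![P.1, Q.1, T.1] c.1 ∘ π.symm := by
    intro π T
    funext ⟨κ, i⟩
    fin_cases κ <;> rfl
  have hfirst : 7 / 8 ≤ expect (fun c : Pos s => ![P.1, Q.1, P.1] c.1) G := by
    refine le_expect_symmetrize fun π => ?_
    have := (hsolve π).1
    rw [probFirst_eq_expect, hlaw] at this
    linarith
  have hsecond : expect (fun c : Pos s => ![P.1, Q.1, Q.1] c.1) G ≤ 1 / 8 := by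
    refine expect_symmetrize_le fun π => ?_
    have := (hsolve π).2
    rw [probSecond_eq, probFirst_eq_expect, hlaw] at this
    linarith
  have hone : ∀ T : Dist n, (∀ z ∉ D, T.1 z = P.1 z) →
      (∀ z ∈ D, T.1 z = 0 ∨ P.1 z + Q.1 z = T.1 z) → (∀ z ∈ D, T.1 z ≤ |P.1 z - Q.1 z|) →
      |expect (fun c : Pos s => ![P.1, Q.1, T.1] c.1) G -
        expect (fun (c : Pos s) x => labelMass u v (![P.1, Q.1, T.1] c.1) x)
          (fun l => coinMean fun β => extendStat G (hybrid u v D 0 l β))| ≤ 5 / 16 := by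
    intro T hT1 hT2 hT3
    have key := abs_expect_sub_forget_le (W := ![P.1, Q.1, T.1]) (D := D) (σ := σ)
      (by
        intro κ z
        fin_cases κ
        exacts [P.2.1 z, Q.2.1 z, T.2.1 z])
      (by
        intro κ
        fin_cases κ
        exacts [P.2.2, Q.2.2, T.2.2])
      (by
        intro z hz κ
        fin_cases κ
        exacts [rfl, ((hD z).1 hz).symm, hT1 z hz])
      hP hT2 huv hu' hv' hle hY ?_ ?_ hcase hF hF01
    · simp only [hFG] at key
      exact key
    · refine le_trans (mul_le_mul_of_nonneg_left ?_ (by positivity)) h3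
      refine (Finset.sum_le_sum fun z hz => pow_le_pow_left₀ (T.2.1 z) (hT3 z hz) 3).trans ?_
      exact Finset.sum_le_sum_of_subset_of_nonneg (Finset.subset_univ _)
        fun z _ _ => by positivity
    · refine mul_le_mul_of_nonneg_left ?_ (by positivity)
      refine (Finset.sum_le_sum fun z hz => pow_le_pow_left₀ (T.2.1 z) (hT3 z hz) 2).trans ?_
      simp only [sq_abs]
      exact Finset.sum_le_sum_of_subset_of_nonneg (Finset.subset_univ _)
        fun z _ _ => by positivity
  have hoP := hone P (fun _ _ => rfl)
    (fun z hz => by rcases hsingle z hz with ⟨-, h⟩ | ⟨-, h⟩ <;> simp [h])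
    (fun z hz => by
      rcases hsingle z hz with ⟨h', h⟩ | ⟨h', h⟩
      · rw [h, sub_zero]
        exact le_abs_self _
      · rw [h]
        exact abs_nonneg _)
  have hoQ := hone Q (fun z hz => ((hD z).1 hz).symm)
    (fun z hz => by rcases hsingle z hz with ⟨-, h⟩ | ⟨-, h⟩ <;> simp [h])
    (fun z hz => by
      rcases hsingle z hz with ⟨h', h⟩ | ⟨h', h⟩
      · rw [h]
        exact abs_nonneg _
      · rw [h, zero_sub, abs_neg]
        exact le_abs_self _)
  -- After forgetting, both testing laws give the same expectation; through it the two true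
  -- expectations are within 5/8, against the gap 7/8 - 1/8.
  rw [expect_forget_eq (W := ![P.1, Q.1, P.1]) (W' := ![P.1, Q.1, Q.1]) rfl rfl
    (fun z hz => (hD z).1 hz) (P.2.2.trans Q.2.2.symm) hv'] at hoP
  have h1 := abs_le.1 hoP
  have h2 := abs_le.1 hoQ
  linarith [h1.2, h2.1]

theorem Solves.mono {n s : ℕ} {A : Algorithm n s} {ε ε' : ℝ} (h : ε ≤ ε')
    {C : Set (Dist n × Dist n)} (hA : Solves A ε C) : Solves A ε' C := fun X Y hXY =>
  ⟨fun hne => ⟨by linarith [((hA X Y hXY).1 hne).1], by linarith [((hA X Y hXY).1 hne).2]⟩,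
    fun he => ⟨by linarith [((hA X Y hXY).2 he).1], by linarith [((hA X Y hXY).2 he).2]⟩⟩

theorem IsPolylog.tendsto_div_sq {L : ℕ → ℝ} (hL : IsPolylog L) :
    Filter.Tendsto (fun s : ℕ => L s / (s : ℝ) ^ 2) Filter.atTop (nhds 0) := by
  obtain ⟨k, hk⟩ := hL
  have h1 : (fun s : ℕ => Real.log (s : ℝ) ^ k) =o[Filter.atTop] fun s : ℕ => (s : ℝ) ^ 2 := by
    have h2 : (fun x : ℝ => Real.log x ^ k) =o[Filter.atTop] fun x : ℝ => x ^ (2 : ℕ) := by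
      have h3 := isLittleO_log_rpow_rpow_atTop (s := 2) (k : ℝ) two_pos
      refine h3.congr (fun x => ?_) fun x => ?_
      · rw [Real.rpow_natCast]
      · rw [← Real.rpow_natCast]
        norm_num
    exact h2.comp_tendsto tendsto_natCast_atTop_atTop
  exact (hk.trans_isLittleO h1).tendsto_div_nhds_zero

end Distinguishability

end

theorem mainTheorem2 :
    ∃ c : ℝ, 0 < c ∧
      -- one universal positive error probability cannot be reached, for any number of samples
      (∃ ε₀ : ℝ, 0 < ε₀ ∧
        ∀ (n s : ℕ) (P Q : Distinguishability.Dist n), P ≠ Q →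
          Distinguishability.WeaklyDisjoint P Q →
          (s : ℝ) ≤ Distinguishability.sampleBound c P Q →
          ¬ ∃ A : Distinguishability.Algorithm n s,
            Distinguishability.Solves A ε₀ (Distinguishability.permutedPairs P Q)) ∧
      -- in particular an error `polylog(s) / s ^ 2` cannot, with the same `c` for every polylog
      (∀ L : ℕ → ℝ, Distinguishability.IsPolylog L →
        ∃ s₀ : ℕ, ∀ (n s : ℕ) (P Q : Distinguishability.Dist n), s₀ ≤ s → P ≠ Q →
          Distinguishability.WeaklyDisjoint P Q →
          (s : ℝ) ≤ Distinguishability.sampleBound c P Q →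
          ¬ ∃ A : Distinguishability.Algorithm n s,
            Distinguishability.Solves A (L s / (s : ℝ) ^ 2)
              (Distinguishability.permutedPairs P Q)) := by
  refine ⟨10 ^ 7, by norm_num, ⟨1 / 8, by norm_num, ?_⟩, ?_⟩
  · rintro n s P Q hPQ hwd hs ⟨A, hA⟩
    exact Distinguishability.not_solves_eighth hPQ hwd hs A hA
  · intro L hL
    have hev := hL.tendsto_div_sq.eventually_le_const (u := 1 / 8) (by norm_num)
    obtain ⟨s₀, hs₀⟩ := Filter.eventually_atTop.1 hev
    refine ⟨s₀, ?_⟩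
    rintro n s P Q hss hPQ hwd hs ⟨A, hA⟩
    exact Distinguishability.not_solves_eighth hPQ hwd hs A (hA.mono (hs₀ s hss))
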